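/- **Setting.** For $F:\mathbb N\to\mathbb N\cup\{\infty\}$ let $[\mathcal K_Fx](j)=x(F(j))$ if $F(j)\in\mathbb N$ and $[\mathcal K_Fx](j)=0$ if $F(j)=\infty$. Let $\Omega_{\mathbb N}$ be the set of all such $F$ for which $\mathcal K_F$ is a bounded operator on $\ell^2(\mathbb N)$, let $\Lambda=\{a_{i,j}\}_{i,j\in\mathbb N}$ with $a_{i,j}(F)=1$ if $F(j)=i$ and $a_{i,j}(F)=0$ otherwise, and let $\mathcal M_H$ be the set of non-empty compact subsets of $\mathbb C$ with the Hausdorff metric $d_H$. Let $\Xi(F)=\mathrm{Sp}(\mathcal K_F)$, or let $\Xi(F)=\mathrm{Sp}_{\mathrm{ap}}(\mathcal K_F)=\{\lambda\in\mathbb C:\exists\, g_n\in\ell^2(\mathbb N),\ \|g_n\|=1,\ \|(\mathcal K_F-\lambda I)g_n\|\to0\}$. **Algorithms and towers.** For a computational problem $\{\Xi,\Omega,\mathcal M_H,\Lambda\}$, with $\Xi:\Omega\to\mathcal M_H$ and $\Lambda$ a countable family of maps $\Omega\to\mathbb C$, a *general algorithm* is a map $\Gamma:\Omega\to\mathcal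 M_H$ such that every $A\in\Omega$ has a non-empty finite set $\Lambda_\Gamma(A)\subset\Lambda$ with: if $f(A)=f(B)$ for all $f\in\Lambda_\Gamma(A)$, then $\Lambda_\Gamma(A)=\Lambda_\Gamma(B)$ and $\Gamma(A)=\Gamma(B)$. A *tower of height $k$* consists of maps $\Gamma_{n_k},\Gamma_{n_k,n_{k-1}},\dots,\Gamma_{n_k,\dots,n_1}:\Omega\to\mathcal M_H$, the $\Gamma_{n_k,\dots,n_1}$ being general algorithms, such that for every $A\in\Omega$ one has $\Xi(A)=\lim_{n_k\to\infty}\Gamma_{n_k}(A)$, …, $\Gamma_{n_k,\dots,n_2}(A)=\lim_{n_1\to\infty}\Gamma_{n_k,\dots,n_1}(A)$; for $k=0$ it is a general algorithm equal to $\Xi$. The tower is *arithmetic* if every $\Gamma_{n_k,\dots,n_1}(A)$ is a finite set of complex numbers, computed from $(n_k,\dots,n_1)$ by one BSS machine with an oracle for $\{f(A)\}_{f\in\Lambda}$ and, if all evaluations take values in $\mathbb Q+i\mathbb Q$, also by one oracle Turing machine. The type $\alpha$ of a tower is $G$ (no further restriction) or $A$ (arithmetic). $\mathrm{SCI}_\alpha$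 is the least height of a tower of type $\alpha$ ($\infty$ if there is none), and for $m\ge1$ the problem is in $\Delta_{m+1}^\alpha$ if $\mathrm{SCI}_\alpha\le m$. It is in $\Pi_m^\alpha$ if it is in $\Delta_{m+1}^\alpha$ and there are a tower of type $\alpha$ and height $m$ and sets $X_n(A)\in\mathcal M_H$ with $\Xi(A)\subset X_n(A)$ and $d_H(X_n(A),\Gamma_n(A))\le2^{-n}$ for all $A\in\Omega$ and $n\in\mathbb{N}$, where $\Gamma_n$ denotes $\Gamma_{n_m}$ with $n_m=n$. **Inexact input.** In the problem with *$\Delta_1$-information*, written $\{\Xi,\Omega,\mathcal M_H,\Lambda\}^{\Delta_1}$, the inputs are all families $(\tilde f_n)_{f\in\Lambda,\,n\in\mathbb N}$ of complex numbers such that for some $A\in\Omega$ one has $|\tilde f_n-f(A)|\le2^{-n}$ for all $f$ and $n$; the algorithm may read every $\tilde f_n$ and has to compute $\Xi(A)$. In the rational version, the $\tilde f_n$ are in $\mathbb Q+i\mathbb Q$. **Theorem.** For both choices of $\Xi$, $$\{\Xi,\Omega_{\mathbb N},\mathcal M_H,\Lambda\}\notin\Delta_3^G,\qquad \{\Xi,\Omega_{\mathbb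 N},\mathcal M_H,\Lambda\}\in\Pi_3^A,\qquad \{\Xi,\Omega_{\mathbb N},\mathcal M_H,\Lambda\}^{\Delta_1}\in\Pi_3^A,$$ the last one both for complex and for rational $\Delta_1$-information. That is, $\Xi(F)$ cannot be computed in two successive limits by any algorithm, even with exact input, but it can be computed by an arithmetic $\Pi_3$-tower, even with inexact input. Consequently $\mathrm{SCI}_G=\mathrm{SCI}_A=3$ for the problem with exact input and for the problem with $\Delta_1$-information. -/

import Mathlib

open Filter Topology

/-! ## Computational problems and the SCI hierarchy -/

/-- The space of non-empty compact subsets of `ℂ`, with Mathlib's Hausdorff metric. -/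
abbrev HausdorffSpace : Type := TopologicalSpace.NonemptyCompacts ℂ

/-- A computational problem `{Ξ, Ω, 𝓜_H, Λ}` with primary set `Ω` and evaluation set
`Λ = {f_i : Ω → ℂ}`, indexed by `I`: here `f_i A` is `eval A i`. -/
structure ComputationalProblem (Ω I : Type) where
  eval : Ω → I → ℂ
  Ξ : Ω → HausdorffSpace
  determined : ∀ A B : Ω, Ξ A ≠ Ξ B → ∃ i, eval A i ≠ eval B i

/-- General algorithms: each input `A` comes with a non-empty finite set `Q A` of evaluations that
are read, and an input that agrees with `A` on `Q A` has the same set and the same output. -/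
def IsGeneralAlgorithm {Ω I : Type} (P : ComputationalProblem Ω I) (Γ : Ω → HausdorffSpace) :
    Prop :=
  ∃ Q : Ω → Finset I, ∀ A, (Q A).Nonempty ∧
    ∀ B, (∀ i ∈ Q A, P.eval A i = P.eval B i) → Q A = Q B ∧ Γ A = Γ B

/-- Towers of algorithms of height `k`. The function `Γ_{n_k, …, n_j}` is `Γ [n_k, …, n_j]`, the
empty list giving the problem function; lists longer than `k` play no role. A tower of height `0`
is a general algorithm equal to the problem function. -/
structure IsTower {Ω I : Type} (P : ComputationalProblem Ω I) (k : ℕ)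
    (Γ : List ℕ → Ω → HausdorffSpace) : Prop where
  general : ∀ l : List ℕ, l.length = k → IsGeneralAlgorithm P (Γ l)
  top : ∀ A, Γ [] A = P.Ξ A
  limit : ∀ l : List ℕ, l.length < k → ∀ A,
    Tendsto (fun n : ℕ => Γ (l ++ [n]) A) atTop (𝓝 (Γ l A))

/-! ### Oracle Turing computability -/

/-- Partial recursive functionals: partial functions `ℕ → ℕ` computed by one and the same oracle
machine, uniformly in the oracle `g : ℕ → ℕ`. This is the uniform version of `Nat.RecursiveIn`. -/
inductive RecursiveFunctional : ((ℕ → ℕ) → ℕ →. ℕ) → Prop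
  | zero : RecursiveFunctional fun _ _ => Part.some 0
  | succ : RecursiveFunctional fun _ n => Part.some (n + 1)
  | left : RecursiveFunctional fun _ n => Part.some (Nat.unpair n).1
  | right : RecursiveFunctional fun _ n => Part.some (Nat.unpair n).2
  | oracle : RecursiveFunctional fun g n => Part.some (g n)
  | pair {f h : (ℕ → ℕ) → ℕ →. ℕ} (hf : RecursiveFunctional f) (hh : RecursiveFunctional h) :
      RecursiveFunctional fun g n => Nat.pair <$> f g n <*> h g n
  | comp {f h : (ℕ → ℕ) → ℕ →. ℕ} (hf : RecursiveFunctional f) (hh : RecursiveFunctional h) :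
      RecursiveFunctional fun g n => h g n >>= f g
  | prec {f h : (ℕ → ℕ) → ℕ →. ℕ} (hf : RecursiveFunctional f) (hh : RecursiveFunctional h) :
      RecursiveFunctional fun g p =>
        Nat.rec (f g (Nat.unpair p).1)
          (fun y IH => IH >>= fun i => h g (Nat.pair (Nat.unpair p).1 (Nat.pair y i)))
          (Nat.unpair p).2
  | rfind {f : (ℕ → ℕ) → ℕ →. ℕ} (hf : RecursiveFunctional f) :
      RecursiveFunctional fun g a =>
        Nat.rfind fun n => (fun m => decide (m = 0)) <$> f g (Nat.pair a n)

/-- The rational number `(a - b) / (d + 1)` named by the triple `(a, b, d)`. -/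
def ratOfCode (c : ℕ × ℕ × ℕ) : ℚ := ((c.1 : ℚ) - c.2.1) / (c.2.2 + 1)

/-- Finite codes for the elements of `ℚ + iℚ`. -/
abbrev GaussCode : Type := (ℕ × ℕ × ℕ) × (ℕ × ℕ × ℕ)

/-- The element of `ℚ + iℚ` with a given code. -/
noncomputable def gaussOfCode (c : GaussCode) : ℂ :=
  ((ratOfCode c.1 : ℚ) : ℂ) + ((ratOfCode c.2 : ℚ) : ℂ) * Complex.I

/-- The set `ℚ + iℚ`. -/
def gaussRationals : Set ℂ := {z | ∃ p q : ℚ, z = (p : ℂ) + (q : ℂ) * Complex.I}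

/-- All evaluations take values in `ℚ + iℚ`. -/
def ComputationalProblem.RationalValued {Ω I : Type} (P : ComputationalProblem Ω I) : Prop :=
  ∀ A i, P.eval A i ∈ gaussRationals

/-- The oracle tape `g` holds, at the code of the index `i`, a code of the value `f_i(A)`. -/
def IsOracleTape {Ω I : Type} [Encodable I] (P : ComputationalProblem Ω I) (A : Ω)
    (g : ℕ → ℕ) : Prop :=
  ∀ i : I, ∃ c : GaussCode, g (Encodable.encode i) = Encodable.encode c ∧
    gaussOfCode c = P.eval A i

/-- A single oracle Turing machine computes `Γ_{n_k, …, n_1}(A)` from `(n_k, …, n_1)` and any tape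
with the evaluations of `A`. The output is a list of elements of `ℚ + iℚ`, identified with the
finite set of its entries. -/
def IsTuringComputable {Ω I : Type} [Encodable I] (P : ComputationalProblem Ω I) (k : ℕ)
    (Γ : List ℕ → Ω → HausdorffSpace) : Prop :=
  ∃ Φ, RecursiveFunctional Φ ∧
    ∀ (A : Ω) (g : ℕ → ℕ), IsOracleTape P A g → ∀ l : List ℕ, l.length = k →
      ∃ L : List GaussCode, Encodable.encode L ∈ Φ g (Encodable.encode l) ∧
        (Γ l A : Set ℂ) = {z | ∃ c ∈ L, gaussOfCode c = z}

/-! ### Oracle machines over the reals (BSS machines) -/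

/-- Programs for a machine with real registers `x_0, x_1, x_2, …`, exact arithmetic, comparisons,
indirect addressing and an oracle with complex answers. Machine constants are rational. -/
inductive RealProgram : Type
  /-- `x_r := q` -/
  | const (r : ℕ) (q : ℚ)
  /-- `x_r := x_s + x_t` -/
  | add (r s t : ℕ)
  /-- `x_r := x_s - x_t` -/
  | sub (r s t : ℕ)
  /-- `x_r := x_s * x_t` -/
  | mul (r s t : ℕ)
  /-- `x_r := x_s / x_t` -/
  | div (r s t : ℕ)
  /-- `x_r := x_a`, where `a` is the address in `x_s` -/
  | load (r s : ℕ)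
  /-- `x_a := x_s`, where `a` is the address in `x_r` -/
  | store (r s : ℕ)
  /-- `x_r` and `x_s` receive the real and the imaginary part of the oracle's answer to the
  question whose number is in `x_t` -/
  | query (r s t : ℕ)
  /-- first `p`, then `q` -/
  | seq (p q : RealProgram)
  /-- if `0 < x_r` then `p` else `q` -/
  | ifPos (r : ℕ) (p q : RealProgram)
  /-- while `0 < x_r` do `p` -/
  | whilePos (r : ℕ) (p : RealProgram)

/-- `RealProgram.Runs o p x y`: with the oracle `o`, started with register contents `x`, the
program `p` halts with register contents `y`. -/
inductive RealProgram.Runs (o : ℕ → ℂ) : RealProgram → (ℕ → ℝ) → (ℕ → ℝ) → Prop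
  | const (r : ℕ) (q : ℚ) (x : ℕ → ℝ) : Runs o (.const r q) x (Function.update x r (q : ℝ))
  | add (r s t : ℕ) (x : ℕ → ℝ) : Runs o (.add r s t) x (Function.update x r (x s + x t))
  | sub (r s t : ℕ) (x : ℕ → ℝ) : Runs o (.sub r s t) x (Function.update x r (x s - x t))
  | mul (r s t : ℕ) (x : ℕ → ℝ) : Runs o (.mul r s t) x (Function.update x r (x s * x t))
  | div (r s t : ℕ) (x : ℕ → ℝ) (h : x t ≠ 0) :
      Runs o (.div r s t) x (Function.update x r (x s / x t))
  | load (r s a : ℕ) (x : ℕ → ℝ) (h : x s = (a : ℝ)) :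
      Runs o (.load r s) x (Function.update x r (x a))
  | store (r s a : ℕ) (x : ℕ → ℝ) (h : x r = (a : ℝ)) :
      Runs o (.store r s) x (Function.update x a (x s))
  | query (r s t m : ℕ) (x : ℕ → ℝ) (h : x t = (m : ℝ)) :
      Runs o (.query r s t) x (Function.update (Function.update x r (o m).re) s (o m).im)
  | seq (p q : RealProgram) (x y z : ℕ → ℝ) (hp : Runs o p x y) (hq : Runs o q y z) :
      Runs o (.seq p q) x z
  | ifTrue (r : ℕ) (p q : RealProgram) (x y : ℕ → ℝ) (h : 0 < x r) (hp : Runs o p x y) :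
      Runs o (.ifPos r p q) x y
  | ifFalse (r : ℕ) (p q : RealProgram) (x y : ℕ → ℝ) (h : x r ≤ 0) (hq : Runs o q x y) :
      Runs o (.ifPos r p q) x y
  | whileTrue (r : ℕ) (p : RealProgram) (x y z : ℕ → ℝ) (h : 0 < x r) (hp : Runs o p x y)
      (hw : Runs o (.whilePos r p) y z) : Runs o (.whilePos r p) x z
  | whileFalse (r : ℕ) (p : RealProgram) (x : ℕ → ℝ) (h : x r ≤ 0) :
      Runs o (.whilePos r p) x x

/-- The oracle that answers the question numbered by the code of `i` with `f_i(A)`. -/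
def ComputationalProblem.realOracle {Ω I : Type} [Encodable I] (P : ComputationalProblem Ω I)
    (A : Ω) (m : ℕ) : ℂ :=
  ((Encodable.decode m : Option I).map (P.eval A)).getD 0

/-- A single oracle program over the reals computes `Γ_{n_k, …, n_1}(A)`. It starts with
`n_k, …, n_1` in the first `k` registers and zeros elsewhere, and it halts with the number `N` of
output points in `x_0` and the points `x_{2j+1} + i x_{2j+2}`, `j < N`; this output is identified
with the finite set of these points. -/
def IsBSSComputable {Ω I : Type} [Encodable I] (P : ComputationalProblem Ω I) (k : ℕ)
    (Γ : List ℕ → Ω → HausdorffSpace) : Prop :=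
  ∃ p : RealProgram, ∀ (A : Ω) (l : List ℕ), l.length = k →
    ∃ (y : ℕ → ℝ) (N : ℕ),
      p.Runs (P.realOracle A) (fun r => ((l.getD r 0 : ℕ) : ℝ)) y ∧ y 0 = (N : ℝ) ∧
        (Γ l A : Set ℂ) = {z | ∃ j < N, z = ⟨y (2 * j + 1), y (2 * j + 2)⟩}

/-! ### The hierarchy -/

/-- Types of towers: general and arithmetic. -/
inductive TowerType : Type
  | general
  | arithmetic

/-- A tower of height `k` and of the given type. Arithmetic towers are computed by an oracle BSS
machine and, if all evaluations are in `ℚ + iℚ`, also by an oracle Turing machine. -/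
def IsTowerOfType {Ω I : Type} [Encodable I] :
    TowerType → ComputationalProblem Ω I → ℕ → (List ℕ → Ω → HausdorffSpace) → Prop
  | .general, P, k, Γ => IsTower P k Γ
  | .arithmetic, P, k, Γ =>
      IsTower P k Γ ∧ IsBSSComputable P k Γ ∧ (P.RationalValued → IsTuringComputable P k Γ)

/-- The Solvability Complexity Index: the least height of a tower, `⊤` if there is none. -/
noncomputable def SCI {Ω I : Type} [Encodable I] (α : TowerType) (P : ComputationalProblem Ω I) :
    ℕ∞ :=
  ⨅ k ∈ {k : ℕ | ∃ Γ, IsTowerOfType α P k Γ}, (k : ℕ∞)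

/-- `P ∈ Δ_m^α`. -/
def InDelta {Ω I : Type} [Encodable I] (α : TowerType) (P : ComputationalProblem Ω I) : ℕ → Prop
  | 0 => SCI α P = 0
  | 1 => ∃ Γ, IsTowerOfType α P 1 Γ ∧ ∀ A (n : ℕ), dist (Γ [n] A) (P.Ξ A) ≤ (1 / 2 : ℝ) ^ n
  | m + 2 => SCI α P ≤ ((m + 1 : ℕ) : ℕ∞)

/-- `P ∈ Π_m^α`, for the Hausdorff metric: convergence from above in the last limit, up to an
error of `2^{-n}`. -/
def InPi {Ω I : Type} [Encodable I] (α : TowerType) (P : ComputationalProblem Ω I) : ℕ → Prop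
  | 0 => InDelta α P 0
  | m + 1 => InDelta α P (m + 2) ∧
      ∃ (Γ : List ℕ → Ω → HausdorffSpace) (X : ℕ → Ω → HausdorffSpace),
        IsTowerOfType α P (m + 1) Γ ∧
        ∀ (A : Ω) (n : ℕ), (P.Ξ A : Set ℂ) ⊆ (X n A : Set ℂ) ∧
          dist (X n A) (Γ [n] A) ≤ (1 / 2 : ℝ) ^ n

/-! ### Inexact input -/

/-- The tuple `a = (a_{i,n})` of elements of `S` is `Δ₁`-information for `A`:
`|a_{i,n} - f_i(A)| ≤ 2^{-n}` for all `i` and `n`. -/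
def IsDeltaOneInfo {Ω I : Type} (P : ComputationalProblem Ω I) (S : Set ℂ) (A : Ω)
    (a : I × ℕ → ℂ) : Prop :=
  ∀ i n, a (i, n) ∈ S ∧ dist (a (i, n)) (P.eval A i) ≤ (1 / 2 : ℝ) ^ n

/-- The problem with `Δ₁`-information, the approximate evaluations being elements of `S`. -/
noncomputable def ComputationalProblem.inexact {Ω I : Type} (P : ComputationalProblem Ω I)
    (S : Set ℂ) : ComputationalProblem {a : I × ℕ → ℂ // ∃ A, IsDeltaOneInfo P S A a} (I × ℕ) where
  eval a := a.1
  Ξ a := P.Ξ a.2.choose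
  determined a b h := by
    by_contra hc
    push Not at hc
    exact h (by rw [Subtype.ext (funext hc)])

/-- The problem function of the inexact problem does not depend on the choice of `A`. -/
theorem ComputationalProblem.inexact_Ξ {Ω I : Type} (P : ComputationalProblem Ω I) (S : Set ℂ)
    (a : {a : I × ℕ → ℂ // ∃ A, IsDeltaOneInfo P S A a}) (A : Ω)
    (h : IsDeltaOneInfo P S A a.1) : (P.inexact S).Ξ a = P.Ξ A := by
  by_contra hne
  obtain ⟨i, hi⟩ := P.determined _ _ hne
  have lim : ∀ B, IsDeltaOneInfo P S B a.1 →
      Tendsto (fun n => a.1 (i, n)) atTop (𝓝 (P.eval B i)) := fun B hB =>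
    tendsto_iff_dist_tendsto_zero.2 (squeeze_zero (fun _ => dist_nonneg) (fun n => (hB i n).2)
      (tendsto_pow_atTop_nhds_zero_of_lt_one (by norm_num) (by norm_num)))
  exact hi (tendsto_nhds_unique (lim _ a.2.choose_spec) (lim _ h))

/-! ## The approximate point spectrum -/

/-- The approximate point spectrum of a bounded operator. -/
def approximatePointSpectrum {E : Type*} [NormedAddCommGroup E] [NormedSpace ℂ E]
    (T : E →L[ℂ] E) : Set ℂ :=
  {z | ∃ g : ℕ → E, (∀ n, ‖g n‖ = 1) ∧ Tendsto (fun n => ‖T (g n) - z • g n‖) atTop (𝓝 0)}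

theorem notMem_approximatePointSpectrum_iff {E : Type*} [NormedAddCommGroup E] [NormedSpace ℂ E]
    (T : E →L[ℂ] E) (z : ℂ) :
    z ∉ approximatePointSpectrum T ↔ ∃ c > 0, ∀ x, c * ‖x‖ ≤ ‖T x - z • x‖ := by
  constructor
  · intro h
    by_contra! hc
    apply h
    have key : ∀ n : ℕ, ∃ g : E, ‖g‖ = 1 ∧ ‖T g - z • g‖ ≤ 1 / ((n : ℝ) + 1) := by
      intro n
      obtain ⟨x, hx⟩ := hc (1 / ((n : ℝ) + 1)) (by positivity)
      have hx0 : x ≠ 0 := by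
        rintro rfl
        simp at hx
      have hpos : 0 < ‖x‖ := norm_pos_iff.2 hx0
      refine ⟨((‖x‖⁻¹ : ℝ) : ℂ) • x, ?_, ?_⟩
      · rw [norm_smul]
        simp [hpos.ne']
      · rw [map_smul, smul_comm z, ← smul_sub, norm_smul]
        simp only [Complex.norm_real, norm_inv, norm_norm]
        rw [inv_mul_le_iff₀ hpos, mul_comm]
        exact hx.le
    choose g hg using key
    exact ⟨g, fun n => (hg n).1, squeeze_zero (fun _ => norm_nonneg _) (fun n => (hg n).2)
      tendsto_one_div_add_atTop_nhds_zero_nat⟩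
  · rintro ⟨c, hc, h⟩ ⟨g, hg, hlim⟩
    have := ge_of_tendsto' hlim (fun n => by simpa [hg n] using h (g n))
    linarith

theorem isCompact_approximatePointSpectrum {E : Type*} [NormedAddCommGroup E] [NormedSpace ℂ E]
    (T : E →L[ℂ] E) : IsCompact (approximatePointSpectrum T) := by
  refine Metric.isCompact_of_isClosed_isBounded ?_ ?_
  · rw [← isOpen_compl_iff, Metric.isOpen_iff]
    intro z hz
    obtain ⟨c, hc, h⟩ := (notMem_approximatePointSpectrum_iff T z).1 hz
    refine ⟨c, hc, fun w hw => (notMem_approximatePointSpectrum_iff T w).2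
      ⟨c - dist w z, by simpa using hw, fun x => ?_⟩⟩
    have h2 : ‖T x - z • x‖ ≤ ‖T x - w • x‖ + ‖(w - z) • x‖ := by
      refine le_trans (le_of_eq ?_) (norm_add_le _ _)
      rw [sub_smul]
      congr 1
      abel
    rw [norm_smul] at h2
    rw [dist_eq_norm]
    linarith [h x]
  · refine (Metric.isBounded_closedBall (x := (0 : ℂ)) (r := ‖T‖)).subset ?_
    rintro z ⟨g, hg, hlim⟩
    have h1 : ∀ n, ‖z‖ - ‖T‖ ≤ ‖T (g n) - z • g n‖ := fun n => by
      have a1 := norm_sub_norm_le (z • g n) (T (g n))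
      have a2 := T.le_opNorm (g n)
      rw [norm_smul, hg n, norm_sub_rev] at a1
      rw [hg n] at a2
      linarith
    have := ge_of_tendsto' hlim h1
    simpa using this

theorem approximatePointSpectrum_nonempty {E : Type*} [NormedAddCommGroup E] [NormedSpace ℂ E]
    [CompleteSpace E] [Nontrivial E] (T : E →L[ℂ] E) : (approximatePointSpectrum T).Nonempty := by
  have hfr : (frontier (spectrum ℂ T)).Nonempty := by
    refine nonempty_frontier_iff.2 ⟨spectrum.nonempty T, fun hu => ?_⟩
    exact NormedSpace.unbounded_univ ℂ ℂ (hu ▸ spectrum.isBounded T)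
  obtain ⟨z, hz⟩ := hfr
  refine ⟨z, ?_⟩
  by_contra hn
  obtain ⟨c, hc, h⟩ := (notMem_approximatePointSpectrum_iff T z).1 hn
  have hzs : z ∈ spectrum ℂ T := (spectrum.isClosed T).frontier_subset hz
  have hz' : z ∈ closure (spectrum ℂ T)ᶜ := by
    rw [frontier_eq_closure_inter_closure] at hz
    exact hz.2
  obtain ⟨w, hw, hwz⟩ := Metric.mem_closure_iff.1 hz' (c / 2) (by linarith)
  have hunit : IsUnit (algebraMap ℂ (E →L[ℂ] E) w - T) := by
    simpa [spectrum.mem_iff] using hw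
  obtain ⟨u, hu⟩ := hunit
  have happ : ∀ v : ℂ, ∀ x, (algebraMap ℂ (E →L[ℂ] E) v - T) x = v • x - T x := fun v x => by
    simp [Algebra.algebraMap_eq_smul_one]
  have hlow : ∀ x, c / 2 * ‖x‖ ≤ ‖(u : E →L[ℂ] E) x‖ := by
    intro x
    rw [hu, happ, norm_sub_rev]
    have h2 : ‖T x - z • x‖ ≤ ‖T x - w • x‖ + ‖(w - z) • x‖ := by
      refine le_trans (le_of_eq ?_) (norm_add_le _ _)
      rw [sub_smul]
      congr 1
      abel
    rw [norm_smul] at h2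
    rw [dist_comm, dist_eq_norm] at hwz
    nlinarith [h x, norm_nonneg x]
  have hinv : ‖((u⁻¹ : (E →L[ℂ] E)ˣ) : E →L[ℂ] E)‖ ≤ 2 / c := by
    refine ContinuousLinearMap.opNorm_le_bound _ (by positivity) fun y => ?_
    have h3 := hlow (((u⁻¹ : (E →L[ℂ] E)ˣ) : E →L[ℂ] E) y)
    rw [← mul_apply_eq_comp, Units.mul_inv, one_apply_eq_self] at h3
    rw [div_mul_eq_mul_div, le_div_iff₀ hc]
    linarith
  have hpos : 0 < ‖((u⁻¹ : (E →L[ℂ] E)ˣ) : E →L[ℂ] E)‖ := Units.norm_pos _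
  have hnear : ‖(algebraMap ℂ (E →L[ℂ] E) z - T) - u‖ <
      ‖((u⁻¹ : (E →L[ℂ] E)ˣ) : E →L[ℂ] E)‖⁻¹ := by
    rw [hu, sub_sub_sub_cancel_right, ← map_sub, norm_algebraMap', ← dist_eq_norm]
    refine lt_of_lt_of_le hwz ?_
    rw [← inv_div]
    exact inv_anti₀ hpos hinv
  exact (spectrum.mem_iff.1 hzs) (u.ofNearby _ hnear).isUnit

/-! ## Koopman operators of discrete-space systems -/

/-- The Hilbert space `ℓ²(ℕ)`. -/
abbrev EllTwo : Type := lp (fun _ : ℕ => ℂ) 2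

/-- The Koopman action `x ↦ x ∘ F` on sequences, with value `0` where `F` is `∞`. -/
def koopmanAction (F : ℕ → ℕ∞) (x : ℕ → ℂ) (j : ℕ) : ℂ :=
  if F j = ⊤ then 0 else x (F j).toNat

/-- The maps `F : ℕ → ℕ ∪ {∞}` whose Koopman operator is a bounded operator on `ℓ²(ℕ)`. -/
def DiscreteSystem : Type :=
  {F : ℕ → ℕ∞ // ∃ K : EllTwo →L[ℂ] EllTwo, ∀ (x : EllTwo) (j : ℕ), K x j = koopmanAction F x j}

/-- The Koopman operator on `ℓ²(ℕ)`; it is determined by its action on sequences. -/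
noncomputable def koopman (F : DiscreteSystem) : EllTwo →L[ℂ] EllTwo := F.2.choose

instance ellTwo_nontrivial : Nontrivial EllTwo :=
  ⟨⟨lp.single 2 0 1, 0, fun h => by
    have := congrArg (fun x : EllTwo => x 0) h
    simp at this⟩⟩

/-- `Sp(K_F)` as a non-empty compact set. -/
noncomputable def koopmanSpectrum (F : DiscreteSystem) : HausdorffSpace where
  carrier := spectrum ℂ (koopman F)
  isCompact' := spectrum.isCompact _
  nonempty' := spectrum.nonempty _

/-- `Sp_ap(K_F)` as a non-empty compact set. -/
noncomputable def koopmanApproximatePointSpectrum (F : DiscreteSystem) : HausdorffSpace where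
  carrier := approximatePointSpectrum (koopman F)
  isCompact' := isCompact_approximatePointSpectrum _
  nonempty' := approximatePointSpectrum_nonempty _

open Classical in
/-- The evaluations `F ↦ δ_{F(j), i}`, indexed by `(i, j)`. -/
noncomputable def sample (F : DiscreteSystem) (ij : ℕ × ℕ) : ℂ :=
  if F.1 ij.2 = (ij.1 : ℕ∞) then 1 else 0

theorem sample_injective {F G : DiscreteSystem} (h : ∀ ij, sample F ij = sample G ij) : F = G := by
  have key : ∀ i j : ℕ, F.1 j = (i : ℕ∞) ↔ G.1 j = (i : ℕ∞) := by
    intro i j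
    have := h (i, j)
    unfold sample at this
    by_cases h1 : F.1 j = (i : ℕ∞) <;> by_cases h2 : G.1 j = (i : ℕ∞) <;> simp_all
  refine Subtype.ext (funext fun j => ?_)
  cases hF : F.1 j with
  | coe n => exact ((key n j).1 hF).symm
  | top =>
    cases hG : G.1 j with
    | coe n => exact absurd ((key n j).2 hG) (by simp [hF])
    | top => rfl

/-- Learning a set `Ξ F` from the samples of `F`. -/
noncomputable def sampleProblem (Ξ : DiscreteSystem → HausdorffSpace) :
    ComputationalProblem DiscreteSystem (ℕ × ℕ) where
  eval := sample
  Ξ := Ξ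
  determined F G hne := by
    by_contra hc
    push Not at hc
    exact hne (by rw [sample_injective hc])

/-!
Lower bound: a zero-one array `a` turns `ℕ` into disjoint chains, one for each column, which is
finite, of length at least the index of the column, or bi-infinite, according as the column has
finitely or infinitely many ones. If infinitely many columns are finite, arbitrarily long Jordan
chains fill the open unit disc with approximate eigenvalues. Otherwise the operator is, up to a
nilpotent part, a bilateral shift, and its spectrum misses the punctured open disc. Each entry of
the graph of the chain system depends on finitely many entries of `a`, so a tower of height two
would write the set of arrays with infinitely many finite columns as a countable union of `Gδ`
sets. By Baire's theorem it is not such a union.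

Upper bound: `z` belongs to the approximate point spectrum if and only if, for every `n`, points
near `z` have `2 ^ (-n)`-approximate eigenvectors, which can be taken rational and finitely
supported. The matrix consists of zeros and ones and its columns and rows are finite, so that a
large enough window of it decides exactly whether a given vector is such an eigenvector. The limits
are over the window, the list of vectors and points, and `n`. The rest of the spectrum consists of
the conjugates of the approximate eigenvalues of the adjoint.
-/

/-! ## Koopman operators of partial injections -/

theorem koopman_apply (F : DiscreteSystem) (x : EllTwo) (j : ℕ) :
    koopman F x j = koopmanAction F.1 x j :=
  F.2.choose_spec x j

theorem koopman_single_apply (F : DiscreteSystem) (i j : ℕ) :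
    koopman F (lp.single 2 i 1) j = sample F (i, j) := by
  rw [koopman_apply]
  cases h : F.1 j <;> simp [koopmanAction, sample, h, Pi.single_apply]

section PartialInjection

variable (f : ℕ ≃. ℕ)

theorem sum_norm_elim_rpow_le (x : EllTwo) (s : Finset ℕ) :
    ∑ j ∈ s, ‖(f j).elim (0 : ℂ) x‖ ^ (2 : ENNReal).toReal ≤ ‖x‖ ^ (2 : ENNReal).toReal := by
  have hinj : ∀ j j' i, i ∈ f j → i ∈ f j' → j = j' := fun j j' i => f.inj
  calc ∑ j ∈ s, ‖(f j).elim (0 : ℂ) x‖ ^ (2 : ENNReal).toReal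
      = ∑ i ∈ s.filterMap f hinj, ‖x i‖ ^ (2 : ENNReal).toReal := by
        refine Finset.sum_bij_ne_zero (fun j _ _ => (f j).getD 0) ?_ ?_ ?_ ?_
        · intro j hj hne
          cases h : f j with
          | none => simp [h] at hne
          | some i => exact (Finset.mem_filterMap _).2 ⟨j, hj, h⟩
        · intro j _ hj j' _ hj' h
          cases h1 : f j with
          | none => simp [h1] at hj
          | some i => cases h2 : f j' with
            | none => simp [h2] at hj'
            | some i' => exact f.inj h1 (by simp_all)
        · intro i hi hne
          obtain ⟨j, hj, h⟩ := (Finset.mem_filterMap _).1 hi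
          exact ⟨j, hj, by simpa [h] using hne, by simp [h]⟩
        · intro j _ hj
          cases h : f j <;> simp_all
    _ ≤ ‖x‖ ^ (2 : ENNReal).toReal := lp.sum_rpow_le_norm_rpow (by simp) x _

/-- Composition with a partial injection, as an operator on `ℓ²(ℕ)`. -/
noncomputable def pequivComp : EllTwo →L[ℂ] EllTwo :=
  LinearMap.mkContinuous
    { toFun x := ⟨fun j => (f j).elim 0 x, memℓp_gen' (sum_norm_elim_rpow_le f x)⟩
      map_add' x y := by
        ext j
        change (f j).elim 0 (x + y : ℕ → ℂ) = (f j).elim 0 x + (f j).elim 0 y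
        cases f j <;> simp
      map_smul' c x := by
        ext j
        change (f j).elim 0 (c • x : ℕ → ℂ) = c * (f j).elim 0 x
        cases f j <;> simp }
    1 fun x => by
      rw [one_mul]
      exact lp.norm_le_of_forall_sum_le (by simp) (norm_nonneg x) (sum_norm_elim_rpow_le f x)

theorem pequivComp_apply (x : EllTwo) (j : ℕ) : pequivComp f x j = (f j).elim 0 x := rfl

theorem pequivComp_single (i : ℕ) :
    pequivComp f (lp.single 2 i 1) = (f.symm i).elim 0 (lp.single 2 · 1) := by
  ext j
  rw [pequivComp_apply]
  by_cases h : f j = some i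
  · simp [h, f.eq_some_iff.2 h]
  · have hl : (f j).elim (0 : ℂ) (lp.single 2 i 1 : EllTwo) = 0 := by
      cases hj : f j <;> simp_all
    rw [hl]
    cases hi : f.symm i with
    | none => rfl
    | some j' =>
      have hne : j ≠ j' := fun hj => h (hj ▸ f.eq_some_iff.1 hi)
      simp [hne]

theorem norm_pequivComp_le : ‖pequivComp f‖ ≤ 1 :=
  LinearMap.mkContinuous_norm_le _ zero_le_one _

/-- The system that moves along the partial injection `f`, with the value `∞` off its domain. -/
noncomputable def DiscreteSystem.ofPEquiv : DiscreteSystem where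
  val j := (f j).elim ⊤ (↑)
  property := ⟨pequivComp f, fun x j => by
    rw [pequivComp_apply]
    cases h : f j <;> simp [koopmanAction, h]⟩

theorem DiscreteSystem.ofPEquiv_eq_coe_iff {i j : ℕ} :
    (DiscreteSystem.ofPEquiv f).1 j = (i : ℕ∞) ↔ f j = some i := by
  change (f j).elim ⊤ (↑) = (i : ℕ∞) ↔ _
  cases f j <;> simp

theorem koopman_ofPEquiv : koopman (.ofPEquiv f) = pequivComp f := by
  ext x j
  rw [koopman_apply, pequivComp_apply]
  cases h : f j <;> simp [koopmanAction, DiscreteSystem.ofPEquiv, h]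

/-- The orbit of `j` under the partial injection `f`, with value `none` once it has left the
domain. -/
def forwardOrbit (j : ℕ) : ℕ → Option ℕ
  | 0 => some j
  | n + 1 => (forwardOrbit j n).bind f

theorem forwardOrbit_succ_of_eq {i j : ℕ} (h : f i = some j) (n : ℕ) :
    forwardOrbit f i (n + 1) = forwardOrbit f j n := by
  induction n with
  | zero => simp [forwardOrbit, h]
  | succ n ih => rw [forwardOrbit, ih, forwardOrbit]

theorem isSome_forwardOrbit_of_le {j m n : ℕ} (hmn : m ≤ n) (h : (forwardOrbit f j n).isSome) :
    (forwardOrbit f j m).isSome := by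
  induction hmn with
  | refl => exact h
  | step _ ih => exact ih (Option.isSome_of_isSome_bind h)

theorem pequivComp_pow_apply (n : ℕ) (x : EllTwo) (j : ℕ) :
    (pequivComp f ^ n) x j = (forwardOrbit f j n).elim 0 x := by
  induction n generalizing x with
  | zero => rfl
  | succ n ih =>
    rw [pow_succ, mul_apply_eq_comp, ih, forwardOrbit]
    cases forwardOrbit f j n <;> simp [pequivComp_apply]

end PartialInjection

theorem exists_mul_eq_one_of_pow_succ_mul {A : Type*} [Ring A] [Algebra ℂ A] {k m : A} {z : ℂ}
    {N : ℕ} (hz : z ≠ 0) (hu : IsUnit (1 - z • m)) (h : k ^ (N + 1) * m = k ^ N) :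
    ∃ r, (algebraMap ℂ A z - k) * r = 1 := by
  set d := algebraMap ℂ A z - k with hd
  obtain ⟨u, hu⟩ := hu
  have hcomm : Commute (algebraMap ℂ A z) k := Algebra.commutes z k
  have hdvd : d ∣ k ^ N := by
    have : k ^ N * u = -(d * k ^ N * m) := by
      have hk : d * k ^ N * m = z • (k ^ N * m) - k ^ (N + 1) * m := by
        rw [hd, sub_mul, sub_mul, ← pow_succ', ← Algebra.smul_def, smul_mul_assoc]
      rw [hk, h, hu, mul_sub, mul_one, mul_smul_comm, neg_sub]
    rw [← Units.dvd_mul_right (u := u), this, mul_assoc]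
    exact (dvd_mul_right d _).neg_right
  have hz' : d ∣ algebraMap ℂ A z ^ N := by
    simpa using dvd_add (hcomm.sub_dvd_pow_sub_pow N) hdvd
  obtain ⟨e, he⟩ := hz'
  refine ⟨e * algebraMap ℂ A (z ^ N)⁻¹, ?_⟩
  rw [← mul_assoc, ← he, ← map_pow, ← map_mul, mul_inv_cancel₀ (pow_ne_zero N hz), map_one]

theorem notMem_spectrum_of_pow_succ {A : Type*} [NormedRing A] [NormedAlgebra ℂ A]
    [CompleteSpace A] {k m : A} {z : ℂ} {N : ℕ} (hz : z ≠ 0) (hzm : ‖z • m‖ < 1)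
    (hr : k ^ (N + 1) * m = k ^ N) (hl : m * k ^ (N + 1) = k ^ N) : z ∉ spectrum ℂ k := by
  have hu : IsUnit (1 - z • m) := ⟨Units.oneSub _ hzm, rfl⟩
  rw [spectrum.notMem_iff, isUnit_iff_exists_and_exists]
  refine ⟨exists_mul_eq_one_of_pow_succ_mul hz hu hr, ?_⟩
  obtain ⟨r, h⟩ := exists_mul_eq_one_of_pow_succ_mul (k := MulOpposite.op k)
    (m := MulOpposite.op m) (N := N) hz (by simpa using hu.op)
    (by simp only [← MulOpposite.op_pow, ← MulOpposite.op_mul, hl])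
  exact ⟨r.unop, by simpa using congrArg MulOpposite.unop h⟩

theorem mem_approximatePointSpectrum_of_chains {E : Type*} [NormedAddCommGroup E]
    [NormedSpace ℂ E] (T : E →L[ℂ] E) {z : ℂ} (hz : ‖z‖ < 1)
    (h : ∀ n, ∃ e : ℕ → E, T (e 0) = 0 ∧ (∀ k < n, T (e (k + 1)) = e k) ∧ ‖e n‖ ≤ 1 ∧
      1 ≤ ‖∑ k ∈ Finset.range (n + 1), z ^ k • e k‖) :
    z ∈ approximatePointSpectrum T := by
  by_contra hn
  obtain ⟨c, hc, hlow⟩ := (notMem_approximatePointSpectrum_iff T z).1 hn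
  obtain ⟨n, hzn⟩ := exists_pow_lt_of_lt_one hc hz
  obtain ⟨e, h0, hs, hen, hsum⟩ := h n
  have tele : ∀ m ≤ n, T (∑ k ∈ Finset.range (m + 1), z ^ k • e k) -
      z • ∑ k ∈ Finset.range (m + 1), z ^ k • e k = -(z ^ (m + 1) • e m) := by
    intro m hm
    induction m with
    | zero => simp [h0]
    | succ m ih =>
      rw [Finset.sum_range_succ, map_add, smul_add, add_sub_add_comm, ih (by lia), map_smul,
        hs m hm, smul_smul, ← pow_succ']
      abel
  have := hlow (∑ k ∈ Finset.range (n + 1), z ^ k • e k)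
  rw [tele n le_rfl, norm_neg, norm_smul, norm_pow, pow_succ] at this
  have hzn' : ‖z‖ ^ n * ‖z‖ * ‖e n‖ ≤ ‖z‖ ^ n :=
    mul_le_of_le_one_right (by positivity) hen |>.trans
      (mul_le_of_le_one_right (by positivity) hz.le)
  nlinarith

section OrbitSpectrum

variable {f : ℕ ≃. ℕ} {z : ℂ}

theorem notMem_spectrum_koopman_ofPEquiv (hz : z ≠ 0) (hz1 : ‖z‖ < 1) {N : ℕ}
    (h : ∀ i j, forwardOrbit f j N = some i → (f i).isSome ∧ (f.symm j).isSome) :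
    z ∉ spectrum ℂ (koopman (.ofPEquiv f)) := by
  rw [koopman_ofPEquiv]
  refine notMem_spectrum_of_pow_succ (m := pequivComp f.symm) (N := N) hz ?_ ?_ ?_
  · rw [norm_smul]
    nlinarith [norm_pequivComp_le f.symm, norm_nonneg (pequivComp f.symm), norm_nonneg z]
  · ext x j
    rw [pow_succ, mul_assoc, mul_apply_eq_comp, pequivComp_pow_apply, pequivComp_pow_apply]
    cases hi : forwardOrbit f j N with
    | none => rfl
    | some i =>
      obtain ⟨i', hi'⟩ := Option.isSome_iff_exists.1 (h i j hi).1
      simp [pequivComp_apply, hi', (f.eq_some_iff).2 hi']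
  · ext x j
    rw [mul_apply_eq_comp, pequivComp_apply, pequivComp_pow_apply]
    cases hi : f.symm j with
    | none =>
      have : forwardOrbit f j N = none := by
        by_contra hne
        obtain ⟨i, hi'⟩ := Option.ne_none_iff_exists'.1 hne
        simpa [hi] using (h i j hi').2
      rw [this]
      rfl
    | some i =>
      rw [Option.elim_some, pequivComp_pow_apply,
        forwardOrbit_succ_of_eq f (f.eq_some_iff.1 hi)]

theorem mem_approximatePointSpectrum_koopman_ofPEquiv (hz1 : ‖z‖ < 1)
    (h : ∀ n, ∃ j, f.symm j = none ∧ (forwardOrbit f j n).isSome) :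
    z ∈ approximatePointSpectrum (koopman (.ofPEquiv f)) := by
  rw [koopman_ofPEquiv]
  refine mem_approximatePointSpectrum_of_chains _ hz1 fun n => ?_
  obtain ⟨j, hj, hn⟩ := h n
  let e : ℕ → EllTwo := fun k => (forwardOrbit f j k).elim 0 (lp.single 2 · 1)
  have hstep : ∀ k < n, ∃ a b, forwardOrbit f j k = some a ∧ f a = some b ∧
      forwardOrbit f j (k + 1) = some b := by
    intro k hk
    obtain ⟨b, hb⟩ := Option.isSome_iff_exists.1 (isSome_forwardOrbit_of_le f hk hn)
    obtain ⟨a, ha, hab⟩ := Option.bind_eq_some_iff.1 hb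
    exact ⟨a, b, ha, hab, hb⟩
  have hcoord : (∑ k ∈ Finset.range (n + 1), z ^ k • e k) j = 1 := by
    rw [lp.coeFn_sum, Finset.sum_apply, Finset.sum_range_succ', Finset.sum_eq_zero]
    · simp [e, forwardOrbit]
    · intro k hk
      obtain ⟨a, b, -, hab, hb⟩ := hstep k (Finset.mem_range.1 hk)
      have hne : j ≠ b := by
        rintro rfl
        simp [f.eq_some_iff.2 hab] at hj
      simp [e, hb, hne]
  refine ⟨e, ?_, fun k hk => ?_, ?_, ?_⟩
  · simp [e, forwardOrbit, pequivComp_single, hj]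
  · obtain ⟨a, b, ha, hab, hb⟩ := hstep k hk
    simp [e, ha, hb, pequivComp_single, f.eq_some_iff.2 hab]
  · obtain ⟨a, ha⟩ := Option.isSome_iff_exists.1 hn
    simp [e, ha]
  · rw [← norm_one (α := ℂ), ← hcoord]
    exact lp.norm_apply_le_norm two_ne_zero _ j

end OrbitSpectrum

/-! ## A Baire category argument -/

-- Baire's theorem in `ℕ → α` for discrete `α`: some `H n` is dense in a cylinder.
theorem exists_cylinder_of_iUnion_eq_univ {α : Type*} [Nonempty α] {H : ℕ → Set (ℕ → α)}
    (h : ⋃ n, H n = Set.univ) :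
    ∃ (n : ℕ) (x : ℕ → α) (s : Finset ℕ), ∀ y : ℕ → α, (∀ i ∈ s, y i = x i) →
      ∀ t : Finset ℕ, ∃ b ∈ H n, ∀ i ∈ t, b i = y i := by
  let _ : TopologicalSpace α := ⊥
  have : DiscreteTopology α := ⟨rfl⟩
  obtain ⟨n, x, hx⟩ := nonempty_interior_of_iUnion_of_closed (f := fun n => closure (H n))
    (fun n => isClosed_closure)
    (Set.univ_subset_iff.1 (h ▸ Set.iUnion_mono fun n => subset_closure))
  obtain ⟨s, u, hu, hsub⟩ := isOpen_pi_iff.1 isOpen_interior x hx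
  refine ⟨n, x, s, fun y hy t => ?_⟩
  have hyH : y ∈ closure (H n) := interior_subset (hsub fun i hi => hy i hi ▸ (hu i hi).2)
  obtain ⟨b, hb, hbH⟩ := mem_closure_iff.1 hyH ((t : Set ℕ).pi fun i => {y i})
    (isOpen_set_pi t.finite_toSet fun i _ => isOpen_discrete _) (fun i _ => rfl)
  exact ⟨b, hbH, hb⟩

theorem dense_preimage_piecewise {Y : Type*} [TopologicalSpace Y] {D : Set Y} (hd : Dense D)
    {H : Set (ℕ → Y)} {x : ℕ → D} {s : Finset ℕ}
    (h : ∀ y : ℕ → D, (∀ i ∈ s, y i = x i) →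
      ∀ t : Finset ℕ, ∃ b : ℕ → D, (fun i => (b i : Y)) ∈ H ∧ ∀ i ∈ t, b i = y i) :
    Dense ((fun a => s.piecewise (fun i => (x i : Y)) a) ⁻¹' H) := by
  classical
  refine dense_iff_inter_open.2 fun V hV ⟨a, ha⟩ => ?_
  obtain ⟨t, u, hu, hV⟩ := isOpen_pi_iff.1 hV a ha
  have hy : ∀ i, ∃ y : D, (i ∈ s → y = x i) ∧ (i ∉ s → i ∈ t → (y : Y) ∈ u i) := by
    intro i
    by_cases hi : i ∈ t ∧ i ∉ s
    · obtain ⟨y, hyu, hyD⟩ := hd.inter_open_nonempty _ (hu i hi.1).1 ⟨_, (hu i hi.1).2⟩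
      exact ⟨⟨y, hyD⟩, by grind⟩
    · exact ⟨x i, by grind⟩
  choose y hys hyu using hy
  obtain ⟨b, hbH, hb⟩ := h y hys (s ∪ t)
  refine ⟨s.piecewise a fun i => b i, hV fun i hi => ?_, ?_⟩
  · by_cases his : i ∈ s
    · simpa [his] using (hu i hi).2
    · simpa [his, hb i (by grind)] using hyu i his hi
  · suffices s.piecewise (fun i => (x i : Y)) (s.piecewise a fun i => b i) = fun i => (b i : Y) by
      rwa [Set.mem_preimage, this]
    ext i
    by_cases his : i ∈ s
    · simp [his, hb i (by grind), hys i his]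
    · simp [his]

theorem iUnion_isGδ_ne_setOf_frequently_mem {Y : Type*} [TopologicalSpace Y] [BaireSpace (ℕ → Y)]
    {D : Set Y} (hne : D.Nonempty) (hd : Dense D) (hD : Dᶜ ∈ residual Y)
    {G : ℕ → Set (ℕ → Y)} (hG : ∀ n, IsGδ (G n)) :
    ⋃ n, G n ≠ {a | ∃ᶠ i in atTop, a i ∈ D} := by
  intro heq
  have : Nonempty D := hne.to_subtype
  have : Nonempty Y := hne.to_type
  obtain ⟨n, x, s, hs⟩ := exists_cylinder_of_iUnion_eq_univ (α := D)
    (H := fun n => {b | (fun i => (b i : Y)) ∈ G n}) (Set.eq_univ_of_forall fun b => by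
      have : (fun i => (b i : Y)) ∈ ⋃ n, G n := heq ▸ Frequently.of_forall fun i => (b i).2
      simpa using this)
  let φ : (ℕ → Y) → ℕ → Y := fun a => s.piecewise (fun i => (x i : Y)) a
  have hφ : Continuous φ := by
    refine continuous_pi fun i => ?_
    by_cases hi : i ∈ s <;> simp only [φ, hi, not_false_eq_true, Finset.piecewise_eq_of_mem,
      Finset.piecewise_eq_of_notMem] <;> fun_prop
  have hcol : ∀ᶠ a : ℕ → Y in residual (ℕ → Y), ∀ i, a i ∉ D :=
    eventually_countable_forall.2 fun i => (tendsto_residual_of_isOpenMap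
      (f := fun a : ℕ → Y => a i) (continuous_apply i) (isOpenMap_eval i)).eventually hD
  obtain ⟨a, haG, haD⟩ := (dense_of_mem_residual (inter_mem
    (residual_of_dense_Gδ ((hG n).preimage hφ) (dense_preimage_piecewise hd hs)) hcol)).nonempty
  have hfreq : φ a ∈ {a | ∃ᶠ i in atTop, a i ∈ D} := heq ▸ Set.mem_iUnion_of_mem n haG
  have hev : ∀ᶠ i in atTop, i ∉ s := Nat.cofinite_eq_atTop ▸ s.eventually_cofinite_notMem
  exact hfreq (hev.mono fun i hi => by simpa [φ, hi] using haD i)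

theorem isGδ_setOf_frequently_mem {X : Type*} [TopologicalSpace X] {U : ℕ → Set X}
    (hU : ∀ m, IsOpen (U m)) : IsGδ {x | ∃ᶠ m in atTop, x ∈ U m} := by
  have : {x | ∃ᶠ m in atTop, x ∈ U m} = ⋂ N, ⋃ m ≥ N, U m := by
    ext x
    simp [frequently_atTop]
  rw [this]
  exact .iInter fun N => (isOpen_biUnion fun m _ => hU m).isGδ

theorem dense_setOf_eventually_eq {Y : Type*} [TopologicalSpace Y] (c : Y) :
    Dense {y : ℕ → Y | ∀ᶠ t in atTop, y t = c} := by
  refine dense_iff_inter_open.2 fun V hV ⟨y, hy⟩ => ?_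
  obtain ⟨s, u, hu, hV⟩ := isOpen_pi_iff.1 hV y hy
  refine ⟨s.piecewise y fun _ => c, hV fun t ht => ?_, ?_⟩
  · simpa [Finset.mem_coe.1 ht] using (hu t ht).2
  · have hev : ∀ᶠ t in atTop, t ∉ s := Nat.cofinite_eq_atTop ▸ s.eventually_cofinite_notMem
    exact hev.mono fun t ht => by simp [ht]

theorem iUnion_isGδ_ne_setOf_frequently_eventually_eq {G : ℕ → Set (ℕ → ℕ → Bool)}
    (hG : ∀ n, IsGδ (G n)) :
    ⋃ n, G n ≠ {a | ∃ᶠ i in atTop, ∀ᶠ t in atTop, a i t = false} := by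
  refine iUnion_isGδ_ne_setOf_frequently_mem (D := {y | ∀ᶠ t in atTop, y t = false})
    ⟨fun _ => false, .of_forall fun _ => rfl⟩ (dense_setOf_eventually_eq false) ?_ hG
  have hcompl : {y : ℕ → Bool | ∀ᶠ t in atTop, y t = false}ᶜ =
      {y | ∃ᶠ t in atTop, y ∈ {y : ℕ → Bool | y t = true}} := by
    ext y
    simp [Filter.Frequently]
  rw [hcompl]
  refine residual_of_dense_Gδ (isGδ_setOf_frequently_mem fun t => ?_)
    ((dense_setOf_eventually_eq true).mono fun y hy => hy.frequently)
  exact (isOpen_discrete {true}).preimage (continuous_apply (A := fun _ => Bool) t)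

theorem setOf_lt_eq_iUnion_isGδ {X : Type*} [TopologicalSpace X] {g : ℕ → ℕ → X → ℝ}
    {g' : ℕ → X → ℝ} {r : X → ℝ} {c : ℝ} (hg : ∀ n m, Continuous (g n m))
    (hm : ∀ n x, Tendsto (fun m => g n m x) atTop (𝓝 (g' n x)))
    (hn : ∀ x, Tendsto (fun n => g' n x) atTop (𝓝 (r x))) (hc : ∀ x, r x ≠ c) :
    ∃ G : ℕ → Set X, (∀ n, IsGδ (G n)) ∧ ⋃ n, G n = {x | r x < c} := by
  refine ⟨fun N => ⋂ n ≥ N, {x | ∃ᶠ m in atTop, g n m x < c}, fun N => ?_, ?_⟩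
  · refine IsGδ.biInter (Set.to_countable _) fun n _ => ?_
    exact isGδ_setOf_frequently_mem fun m => isOpen_lt (hg n m) continuous_const
  · ext x
    simp only [Set.mem_iUnion, Set.mem_iInter]
    constructor
    · rintro ⟨N, hN⟩
      refine lt_of_le_of_ne (le_of_tendsto (hn x) ?_) (hc x)
      filter_upwards [eventually_ge_atTop N] with n hn
      exact le_of_tendsto_of_frequently (hm n x) ((hN n hn).mono fun m => le_of_lt)
    · intro hx
      obtain ⟨N, hN⟩ := eventually_atTop.1 ((hn x).eventually_lt_const hx)
      exact ⟨N, fun n hn => ((hm n x).eventually_lt_const (hN n hn)).frequently⟩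

/-! ## Chain systems -/

/-- The partial bijection with graph `R`, for a relation `R` that is a partial function in either
direction. -/
noncomputable def pequivOfRel {α β : Type*} (R : α → β → Prop) (hl : Relator.LeftUnique R)
    (hr : Relator.RightUnique R) : α ≃. β := by
  classical
  exact
  { toFun x := if h : ∃ y, R x y then some h.choose else none
    invFun y := if h : ∃ x, R x y then some h.choose else none
    inv x y := by
      simp only [Option.dite_none_right_eq_some]
      constructor <;> rintro ⟨h, h'⟩ <;> have hxy : R x y := Option.some.inj h' ▸ h.choose_spec
      · exact ⟨⟨y, hxy⟩, congrArg some (hr (Exists.choose_spec _) hxy)⟩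
      · exact ⟨⟨x, hxy⟩, congrArg some (hl (Exists.choose_spec (p := (R · y)) _) hxy)⟩ }

theorem pequivOfRel_eq_some_iff {α β : Type*} {R : α → β → Prop} {hl : Relator.LeftUnique R}
    {hr : Relator.RightUnique R} {x : α} {y : β} :
    pequivOfRel R hl hr x = some y ↔ R x y := by
  classical
  change (if h : ∃ y, R x y then some h.choose else none) = some y ↔ R x y
  rw [Option.dite_none_right_eq_some]
  exact ⟨fun ⟨h, h'⟩ => Option.some.inj h' ▸ h.choose_spec,
    fun h => ⟨⟨y, h⟩, congrArg some (hr (Exists.choose_spec _) h)⟩⟩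

/-- The numbering of the space-time points `(i, t)`, column `i` and time `t`, of chain systems. -/
noncomputable def chainPoint : ℕ ≃ ℕ × ℤ := (Denumerable.eqv _).symm

/-- The times at which column `i` of the zero-one matrix `a` is active: a block of radius `i`
around `0` and, symmetrically, the positions of the ones of the column. -/
def IsActive (a : ℕ → ℕ → Bool) (i : ℕ) (t : ℤ) : Prop :=
  t.natAbs ≤ i ∨ a i t.natAbs = true

/-- The point `q` is at the next active time after `p` in the same column. -/
def IsNextActive (a : ℕ → ℕ → Bool) (p q : ℕ × ℤ) : Prop :=
  p.1 = q.1 ∧ IsActive a p.1 p.2 ∧ IsActive a p.1 q.2 ∧ p.2 < q.2 ∧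
    ∀ s, p.2 < s → s < q.2 → ¬ IsActive a p.1 s

section Chain

variable (a : ℕ → ℕ → Bool)

theorem IsNextActive.leftUnique : Relator.LeftUnique (IsNextActive a) := by
  rintro ⟨i, t⟩ ⟨j, u⟩ ⟨k, v⟩ ⟨hik, ht, -, htv, hs⟩ ⟨hjk, hu, -, huv, hs'⟩
  obtain rfl : i = k := hik
  obtain rfl : j = i := hjk
  rcases lt_trichotomy t u with h | rfl | h
  · exact absurd hu (hs u h huv)
  · rfl
  · exact absurd ht (hs' t h htv)

theorem IsNextActive.rightUnique : Relator.RightUnique (IsNextActive a) := by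
  rintro ⟨i, t⟩ ⟨j, u⟩ ⟨k, v⟩ ⟨hij, -, hu, htu, hs⟩ ⟨hik, -, hv, htv, hs'⟩
  obtain rfl : i = j := hij
  obtain rfl : i = k := hik
  rcases lt_trichotomy u v with h | rfl | h
  · exact absurd hu (hs' u htu h)
  · rfl
  · exact absurd hv (hs v htv h)

/-- The map from each active point to the next one, as a partial injection of `ℕ`. -/
noncomputable def chainMap : ℕ ≃. ℕ :=
  pequivOfRel (fun m n => IsNextActive a (chainPoint m) (chainPoint n))
    (fun _ _ _ h h' => chainPoint.injective (IsNextActive.leftUnique a h h'))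
    (fun _ _ _ h h' => chainPoint.injective (IsNextActive.rightUnique a h h'))

/-- The system that moves through the active times of each column of `a`. A finite column is a
single finite chain, an infinite one is a bi-infinite chain. -/
noncomputable def chainSystem : DiscreteSystem := .ofPEquiv (chainMap a)

variable {a}

theorem chainMap_eq_some_iff {m n : ℕ} :
    chainMap a m = some n ↔ IsNextActive a (chainPoint m) (chainPoint n) :=
  pequivOfRel_eq_some_iff

theorem exists_isNextActive {i : ℕ} {t : ℤ} (ht : IsActive a i t)
    (h : ∃ u, t < u ∧ IsActive a i u) : ∃ u, IsNextActive a (i, t) (i, u) := by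
  obtain ⟨u, ⟨htu, hu⟩, hmin⟩ := Int.exists_least_of_bdd ⟨t, fun _ hu => hu.1.le⟩ h
  exact ⟨u, rfl, ht, hu, htu, fun s hts hsu hs => hsu.not_ge (hmin s ⟨hts, hs⟩)⟩

theorem exists_isNextActive_left {i : ℕ} {u : ℤ} (hu : IsActive a i u)
    (h : ∃ t, t < u ∧ IsActive a i t) : ∃ t, IsNextActive a (i, t) (i, u) := by
  obtain ⟨t, ⟨htu, ht⟩, hmax⟩ := Int.exists_greatest_of_bdd ⟨u, fun _ ht => ht.1.le⟩ h
  exact ⟨t, rfl, ht, hu, htu, fun s hts hsu hs => hts.not_ge (hmax s ⟨hsu, hs⟩)⟩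

theorem forwardOrbit_chainMap {m k n : ℕ} (h : forwardOrbit (chainMap a) m n = some k) :
    (chainPoint k).1 = (chainPoint m).1 ∧ (chainPoint m).2 + n ≤ (chainPoint k).2 := by
  induction n generalizing k with
  | zero => cases h; simp
  | succ n ih =>
    obtain ⟨l, hl, hlk⟩ := Option.bind_eq_some_iff.1 h
    obtain ⟨hcol, -, -, hlt, -⟩ := chainMap_eq_some_iff.1 hlk
    obtain ⟨hcol', hle⟩ := ih hl
    exact ⟨hcol.symm.trans hcol', by push_cast; lia⟩

theorem isActive_of_forwardOrbit_chainMap {m k n : ℕ} (hn : n ≠ 0)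
    (h : forwardOrbit (chainMap a) m n = some k) :
    IsActive a (chainPoint m).1 (chainPoint m).2 ∧
      IsActive a (chainPoint m).1 (chainPoint k).2 := by
  obtain ⟨n, rfl⟩ := Nat.exists_eq_succ_of_ne_zero hn
  obtain ⟨l, hl, hlk⟩ := Option.bind_eq_some_iff.1 h
  have h1 := isSome_forwardOrbit_of_le (chainMap a) (m := 1) (n := n + 1) (by lia)
    (h ▸ Option.isSome_some)
  obtain ⟨l', hl'⟩ := Option.isSome_iff_exists.1 h1
  exact ⟨(chainMap_eq_some_iff.1 hl').2.1,
    (forwardOrbit_chainMap hl).1 ▸ (chainMap_eq_some_iff.1 hlk).2.2.1⟩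

theorem isSome_chainMap {m : ℕ} (hinf : ∃ᶠ t in atTop, a (chainPoint m).1 t = true)
    (h : IsActive a (chainPoint m).1 (chainPoint m).2) :
    (chainMap a m).isSome ∧ ((chainMap a).symm m).isSome := by
  obtain ⟨t, ht, hat⟩ := frequently_atTop.1 hinf ((chainPoint m).2.natAbs + 1)
  obtain ⟨u, hu⟩ := exists_isNextActive h ⟨t, by lia, .inr hat⟩
  obtain ⟨s, hs⟩ := exists_isNextActive_left h ⟨-t, by lia, .inr (by simpa using hat)⟩
  refine ⟨Option.isSome_iff_exists.2 ⟨chainPoint.symm ((chainPoint m).1, u), ?_⟩,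
    Option.isSome_iff_exists.2 ⟨chainPoint.symm ((chainPoint m).1, s), ?_⟩⟩
  · simpa [chainMap_eq_some_iff] using hu
  · simpa [(chainMap a).eq_some_iff, chainMap_eq_some_iff] using hs

theorem exists_isSome_forwardOrbit_of_finite_column {i : ℕ}
    (h : ∀ᶠ t in atTop, a i t = false) :
    ∃ m, (chainMap a).symm m = none ∧ (forwardOrbit (chainMap a) m i).isSome := by
  obtain ⟨T, hT⟩ := eventually_atTop.1 h
  obtain ⟨t₀, ht₀, hmin⟩ := Int.exists_least_of_bdd (P := IsActive a i) ⟨-(T + i), fun t ht => by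
    rcases ht with ht | ht
    · lia
    · have : ¬ T ≤ t.natAbs := fun h => by simp [hT _ h] at ht
      lia⟩ ⟨0, .inl (by simp)⟩
  refine ⟨chainPoint.symm (i, t₀), ?_, ?_⟩
  · by_contra hne
    obtain ⟨k, hk⟩ := Option.ne_none_iff_exists'.1 hne
    obtain ⟨hcol, hact, -, hlt, -⟩ := chainMap_eq_some_iff.1 ((chainMap a).eq_some_iff.1 hk)
    simp only [Equiv.apply_symm_apply] at hcol hlt
    exact hlt.not_ge (hmin _ (hcol ▸ hact))
  · have key : ∀ k ≤ i, ∃ t : ℤ, t ≤ k - i ∧ IsActive a i t ∧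
        forwardOrbit (chainMap a) (chainPoint.symm (i, t₀)) k = some (chainPoint.symm (i, t)) := by
      intro k hk
      induction k with
      | zero => exact ⟨t₀, hmin _ (.inl (by simp)), ht₀, rfl⟩
      | succ k ih =>
        obtain ⟨t, ht, hact, horb⟩ := ih (by lia)
        obtain ⟨u, hu⟩ := exists_isNextActive hact ⟨i, by lia, .inl (by simp)⟩
        refine ⟨u, ?_, hu.2.2.1, ?_⟩
        · by_contra hlt
          refine hu.2.2.2.2 (max (t + 1) (-i)) ?_ ?_ (.inl ?_) <;> grind
        · rw [forwardOrbit, horb, Option.bind_some, chainMap_eq_some_iff]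
          simpa using hu
    obtain ⟨t, -, -, ht⟩ := key i le_rfl
    simp [ht]

theorem mem_approximatePointSpectrum_chainSystem (h : ∃ᶠ i in atTop, ∀ᶠ t in atTop, a i t = false)
    {z : ℂ} (hz : ‖z‖ < 1) : z ∈ approximatePointSpectrum (koopman (chainSystem a)) := by
  refine mem_approximatePointSpectrum_koopman_ofPEquiv hz fun n => ?_
  obtain ⟨i, hi, hcol⟩ := frequently_atTop.1 h n
  obtain ⟨m, hm, horb⟩ := exists_isSome_forwardOrbit_of_finite_column hcol
  exact ⟨m, hm, isSome_forwardOrbit_of_le _ hi horb⟩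

theorem notMem_spectrum_chainSystem (h : ¬ ∃ᶠ i in atTop, ∀ᶠ t in atTop, a i t = false)
    {z : ℂ} (hz : z ≠ 0) (hz1 : ‖z‖ < 1) : z ∉ spectrum ℂ (koopman (chainSystem a)) := by
  obtain ⟨I, hI⟩ := eventually_atTop.1 (not_frequently.1 h)
  have hT : ∀ i, ∃ T, (∀ᶠ t in atTop, a i t = false) → ∀ t ≥ T, a i t = false := fun i => by
    by_cases hi : ∀ᶠ t in atTop, a i t = false
    · exact (eventually_atTop.1 hi).imp fun T hT _ => hT
    · exact ⟨0, fun h => absurd h hi⟩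
  choose T hT using hT
  let B := I + (Finset.range I).sup T
  have hB : ∀ i t, (∀ᶠ t in atTop, a i t = false) → IsActive a i t → t.natAbs ≤ B := by
    intro i t hi ht
    have hiI : i < I := by
      by_contra hge
      exact hI i (by lia) hi
    have hTi : T i ≤ (Finset.range I).sup T := Finset.le_sup (Finset.mem_range.2 hiI)
    rcases ht with ht | ht
    · lia
    · have : ¬ T i ≤ t.natAbs := fun h => by simp [hT i hi _ h] at ht
      lia
  refine notMem_spectrum_koopman_ofPEquiv hz hz1 (N := 2 * B + 1) fun k m horb => ?_
  obtain ⟨hm, hk⟩ := isActive_of_forwardOrbit_chainMap (by lia) horb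
  obtain ⟨hcol, hlen⟩ := forwardOrbit_chainMap horb
  have hinf : ∃ᶠ t in atTop, a (chainPoint m).1 t = true := by
    by_contra hfin
    have hfin' : ∀ᶠ t in atTop, a (chainPoint m).1 t = false := by
      simpa [Filter.Frequently] using hfin
    have := hB _ _ hfin' hm
    have := hB _ _ hfin' hk
    push_cast at hlen
    lia
  exact ⟨(isSome_chainMap (hcol ▸ hinf) (hcol ▸ hk)).1, (isSome_chainMap hinf hm).2⟩

theorem eventually_isActive_iff (a : ℕ → ℕ → Bool) (i : ℕ) (t : ℤ) :
    ∀ᶠ b in 𝓝 a, IsActive b i t ↔ IsActive a i t := by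
  have hcont : Continuous fun b : ℕ → ℕ → Bool => b i t.natAbs := by fun_prop
  filter_upwards [((IsLocallyConstant.iff_continuous _).2 hcont).eventually_eq a] with b hb
  rw [IsActive, IsActive, hb]

theorem isLocallyConstant_sample_chainSystem (ij : ℕ × ℕ) :
    IsLocallyConstant fun a => sample (chainSystem a) ij := by
  refine (IsLocallyConstant.iff_eventually_eq _).2 fun a => ?_
  obtain ⟨i, j⟩ := ij
  rcases hp : chainPoint j with ⟨c, t⟩
  rcases hq : chainPoint i with ⟨d, u⟩
  filter_upwards [(eventually_all_finset (Finset.Icc t u)).2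
    fun s _ => eventually_isActive_iff a c s] with b hb
  have hnext : IsNextActive b (c, t) (d, u) ↔ IsNextActive a (c, t) (d, u) := by
    rw [IsNextActive, IsNextActive]
    grind
  have hsample : (chainSystem b).1 j = (i : ℕ∞) ↔ (chainSystem a).1 j = (i : ℕ∞) := by
    rw [chainSystem, chainSystem, DiscreteSystem.ofPEquiv_eq_coe_iff,
      DiscreteSystem.ofPEquiv_eq_coe_iff, chainMap_eq_some_iff, chainMap_eq_some_iff, hp, hq, hnext]
  simp only [sample, hsample]

end Chain

/-! ## Lower bounds for the height of towers -/

section LowerBound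

variable {Ω I : Type} {P : ComputationalProblem Ω I}

theorem IsTower.exists_of_le {k m : ℕ} (hkm : k ≤ m) {Γ : List ℕ → Ω → HausdorffSpace}
    (h : IsTower P k Γ) : ∃ Γ', IsTower P m Γ' := by
  refine ⟨fun l => Γ (l.take k), fun l hl => h.general _ (by simp [hl, hkm]), fun A => ?_,
    fun l _ A => ?_⟩
  · simpa using h.top A
  · by_cases hlk : l.length < k
    · have htake : ∀ n, (l ++ [n]).take k = l ++ [n] := fun n =>
        List.take_of_length_le (by simpa using hlk)
      simp only [htake, List.take_of_length_le hlk.le]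
      exact h.limit l hlk A
    · simp only [List.take_append_of_le_length (not_lt.1 hlk)]
      exact tendsto_const_nhds

theorem IsTower.exists_of_inexact {S : Set ℂ} (hS : ∀ A i, P.eval A i ∈ S) {k : ℕ} {Γ}
    (h : IsTower (P.inexact S) k Γ) : ∃ Γ', IsTower P k Γ' := by
  classical
  have hinfo : ∀ A, IsDeltaOneInfo P S A (fun p : I × ℕ => P.eval A p.1) := fun A i n =>
    ⟨hS A i, by simp⟩
  let ι : Ω → {a : I × ℕ → ℂ // ∃ A, IsDeltaOneInfo P S A a} := fun A => ⟨_, A, hinfo A⟩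
  refine ⟨fun l A => Γ l (ι A), fun l hl => ?_, fun A => ?_, fun l hl A => h.limit l hl (ι A)⟩
  · obtain ⟨Q, hQ⟩ := h.general l hl
    refine ⟨fun A => (Q (ι A)).image Prod.fst, fun A => ⟨(hQ (ι A)).1.image _, fun B hB => ?_⟩⟩
    obtain ⟨hQ', hΓ⟩ := (hQ (ι A)).2 (ι B) fun i hi => hB i.1 (Finset.mem_image_of_mem _ hi)
    exact ⟨congrArg (Finset.image Prod.fst) hQ', hΓ⟩
  · exact (h.top (ι A)).trans (P.inexact_Ξ S (ι A) A (hinfo A))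

theorem IsGeneralAlgorithm.isLocallyConstant_comp {X : Type*} [TopologicalSpace X] {c : X → Ω}
    (hc : ∀ i, IsLocallyConstant fun a => P.eval (c a) i) {Γ : Ω → HausdorffSpace}
    (h : IsGeneralAlgorithm P Γ) : IsLocallyConstant fun a => Γ (c a) := by
  obtain ⟨Q, hQ⟩ := h
  refine (IsLocallyConstant.iff_eventually_eq _).2 fun a => ?_
  filter_upwards [(eventually_all_finset (Q (c a))).2 fun i _ => (hc i).eventually_eq a] with b hb
  exact ((hQ (c a)).2 (c b) fun i hi => (hb i hi).symm).2.symm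

variable [Encodable I]

theorem IsTowerOfType.isTower {α : TowerType} {k : ℕ} {Γ : List ℕ → Ω → HausdorffSpace}
    (h : IsTowerOfType α P k Γ) : IsTower P k Γ := by
  cases α with
  | general => exact h
  | arithmetic => exact h.1

theorem SCI_le {α : TowerType} {k : ℕ} {Γ : List ℕ → Ω → HausdorffSpace}
    (h : IsTowerOfType α P k Γ) : SCI α P ≤ k :=
  iInf₂_le k ⟨Γ, h⟩

theorem add_one_le_SCI {k : ℕ} (h : ¬ ∃ Γ, IsTower P k Γ) (α : TowerType) :
    ((k + 1 : ℕ) : ℕ∞) ≤ SCI α P := by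
  refine le_iInf₂ fun m ⟨Γ, hΓ⟩ => ?_
  rw [Nat.cast_le]
  by_contra hlt
  exact h (hΓ.isTower.exists_of_le (by lia))

end LowerBound

theorem approximatePointSpectrum_subset_spectrum {E : Type*} [NormedAddCommGroup E]
    [NormedSpace ℂ E] (T : E →L[ℂ] E) : approximatePointSpectrum T ⊆ spectrum ℂ T := by
  rintro z ⟨g, hg, hlim⟩ ⟨u, hu⟩
  have hug : Tendsto (fun n => (u : E →L[ℂ] E) (g n)) atTop (𝓝 0) := by
    refine tendsto_zero_iff_norm_tendsto_zero.2 (hlim.congr fun n => ?_)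
    rw [hu, norm_sub_rev]
    simp [Algebra.algebraMap_eq_smul_one]
  have hg0 : Tendsto g atTop (𝓝 0) := by
    simpa [← mul_apply_eq_comp, Function.comp_def] using
      ((↑u⁻¹ : E →L[ℂ] E).continuous.tendsto 0).comp hug
  simpa [hg] using hg0.norm

theorem le_infDist_of_notMem_punctured_ball {s : Set ℂ} (hs : s.Nonempty)
    (h : ∀ z ∈ s, z ≠ 0 → 1 ≤ ‖z‖) : 1 / 2 ≤ Metric.infDist (1 / 2 : ℂ) s := by
  refine (Metric.le_infDist hs).2 fun w hw => ?_
  have hnorm : ‖(1 / 2 : ℂ)‖ = 1 / 2 := by norm_num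
  rw [dist_eq_norm]
  by_cases hw0 : w = 0
  · simp [hw0]
  · have := norm_sub_norm_le w (1 / 2 : ℂ)
    rw [norm_sub_rev]
    linarith [h w hw hw0]

theorem not_exists_isTower_two {Ξ : DiscreteSystem → HausdorffSpace}
    (hlow : ∀ F, approximatePointSpectrum (koopman F) ⊆ (Ξ F : Set ℂ))
    (hup : ∀ F, (Ξ F : Set ℂ) ⊆ spectrum ℂ (koopman F)) :
    ¬ ∃ Γ, IsTower (sampleProblem Ξ) 2 Γ := by
  rintro ⟨Γ, h⟩
  let d : HausdorffSpace → ℝ := fun C => Metric.infDist (1 / 2 : ℂ) C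
  have hd : Continuous d := (Metric.lipschitz_infDist_set _).continuous
  have hfin : ∀ a : ℕ → ℕ → Bool, (∃ᶠ i in atTop, ∀ᶠ t in atTop, a i t = false) →
      d (Ξ (chainSystem a)) = 0 := fun a ha =>
    Metric.infDist_zero_of_mem
      (hlow _ (mem_approximatePointSpectrum_chainSystem ha (by norm_num)))
  have hinf : ∀ a : ℕ → ℕ → Bool, ¬ (∃ᶠ i in atTop, ∀ᶠ t in atTop, a i t = false) →
      1 / 2 ≤ d (Ξ (chainSystem a)) := fun a ha =>
    le_infDist_of_notMem_punctured_ball (Ξ (chainSystem a)).nonempty fun z hz hz0 =>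
      not_lt.1 fun hz1 => notMem_spectrum_chainSystem ha hz0 hz1 (hup _ hz)
  have hne : ∀ a, d (Γ [] (chainSystem a)) ≠ 1 / 4 := fun a hda => by
    rw [h.top] at hda
    by_cases ha : ∃ᶠ i in atTop, ∀ᶠ t in atTop, a i t = false
    · exact absurd ((hfin a ha).symm.trans hda) (by norm_num)
    · exact absurd ((hinf a ha).trans_eq hda) (by norm_num)
  obtain ⟨G, hG, hunion⟩ := setOf_lt_eq_iUnion_isGδ (c := 1 / 4)
    (fun n m => (((h.general [n, m] rfl).isLocallyConstant_comp
      isLocallyConstant_sample_chainSystem).comp d).continuous)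
    (fun n a => (hd.tendsto _).comp (h.limit [n] (by simp) (chainSystem a)))
    (fun a => (hd.tendsto _).comp (h.limit [] (by simp) (chainSystem a)))
    hne
  refine iUnion_isGδ_ne_setOf_frequently_eventually_eq hG (hunion.trans ?_)
  ext a
  rw [Set.mem_ofPred_eq, Set.mem_ofPred_eq, h.top]
  by_cases ha : ∃ᶠ i in atTop, ∀ᶠ t in atTop, a i t = false
  · exact iff_of_true ((hfin a ha).trans_lt (by norm_num)) ha
  · exact iff_of_false (not_lt.2 (le_trans (by norm_num) (hinf a ha))) ha

/-! ## Primitive recursion on machines over the reals -/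

namespace RealProgram

theorem Runs.trans {o : ℕ → ℂ} {p q : RealProgram} {x y z : ℕ → ℝ} (hp : p.Runs o x y)
    (hq : q.Runs o y z) : (RealProgram.seq p q).Runs o x z :=
  .seq _ _ _ _ _ hp hq

/-- The assignment `x_r := x_s`, for `s ≠ r`. -/
def move (r s : ℕ) : RealProgram :=
  .seq (.const r s) (.load r r)

/-- The assignment `x_r := x_r + 1`, for `t ≠ r`; the register `t` is overwritten. -/
def increment (r t : ℕ) : RealProgram :=
  .seq (.const t 1) (.add r r t)

/-- The assignment `x_r := x_r - 1`, for `t ≠ r`; the register `t` is overwritten. -/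
def decrement (r t : ℕ) : RealProgram :=
  .seq (.const t 1) (.sub r r t)

variable {o : ℕ → ℂ}

theorem move_runs {r s : ℕ} (h : s ≠ r) (x : ℕ → ℝ) :
    (move r s).Runs o x (Function.update x r (x s)) := by
  have hload := Runs.load (o := o) r r s (Function.update x r (s : ℚ)) (by simp)
  rw [Function.update_idem, Function.update_of_ne h] at hload
  exact (Runs.const r s x).trans hload

theorem increment_runs {r t : ℕ} (h : r ≠ t) (x : ℕ → ℝ) :
    (increment r t).Runs o x (Function.update (Function.update x t 1) r (x r + 1)) := by
  have hadd := Runs.add (o := o) r r t (Function.update x t (1 : ℚ))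
  rw [Function.update_self, Function.update_of_ne h, Rat.cast_one] at hadd
  exact (by simpa using Runs.const t 1 x : Runs o _ x (Function.update x t 1)).trans hadd

theorem decrement_runs {r t : ℕ} (h : r ≠ t) (x : ℕ → ℝ) :
    (decrement r t).Runs o x (Function.update (Function.update x t 1) r (x r - 1)) := by
  have hsub := Runs.sub (o := o) r r t (Function.update x t (1 : ℚ))
  rw [Function.update_self, Function.update_of_ne h, Rat.cast_one] at hsub
  exact (by simpa using Runs.const t 1 x : Runs o _ x (Function.update x t 1)).trans hsub

theorem exists_runs_whilePos {p : RealProgram} {c n : ℕ} {J : ℕ → (ℕ → ℝ) → Prop}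
    (hc : ∀ k x, J k x → x c = (n : ℝ) - k)
    (hstep : ∀ k < n, ∀ x, J k x → ∃ y, p.Runs o x y ∧ J (k + 1) y) {x : ℕ → ℝ} (hx : J 0 x) :
    ∃ y, (whilePos c p).Runs o x y ∧ J n y := by
  suffices H : ∀ k ≤ n, ∀ x, J k x → ∃ y, (whilePos c p).Runs o x y ∧ J n y from
    H 0 n.zero_le x hx
  intro k hk
  induction hk using Nat.decreasingInduction with
  | self => exact fun x hx => ⟨x, .whileFalse c p x (by simp [hc n x hx]), hx⟩
  | of_succ k hk ih =>
    intro x hx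
    obtain ⟨y, hxy, hy⟩ := hstep k hk x hx
    obtain ⟨z, hyz, hz⟩ := ih y hy
    refine ⟨z, .whileTrue c p x y z ?_ hxy hyz, hz⟩
    rw [hc k x hx, sub_pos]
    exact_mod_cast hk

/-- Runs `p` as often as the register `s` says. The number of completed passes is in the register
`c`, the number of remaining ones in `c + 1`, and `c + 2` is overwritten. -/
def forLoop (c s : ℕ) (p : RealProgram) : RealProgram :=
  .seq (.const c 0) (.seq (move (c + 1) s)
    (.whilePos (c + 1) (.seq p (.seq (increment c (c + 2)) (decrement (c + 1) (c + 2))))))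

theorem exists_runs_forLoop {p : RealProgram} {c s n : ℕ} (hs : s < c) {J : ℕ → (ℕ → ℝ) → Prop}
    (hJ : ∀ k x y, (∀ r, r < c ∨ c + 3 ≤ r → y r = x r) → J k x → J k y)
    (hstep : ∀ k < n, ∀ x, x c = (k : ℝ) → J k x →
      ∃ y, p.Runs o x y ∧ y c = x c ∧ y (c + 1) = x (c + 1) ∧ J (k + 1) y)
    {x : ℕ → ℝ} (hx : J 0 x) (hn : x s = n) :
    ∃ y, (forLoop c s p).Runs o x y ∧ y c = n ∧ J n y := by
  let J' (k : ℕ) (x : ℕ → ℝ) : Prop := x c = k ∧ x (c + 1) = (n : ℝ) - k ∧ J k x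
  have hstep' : ∀ k < n, ∀ x, J' k x → ∃ y,
      (RealProgram.seq p (.seq (increment c (c + 2)) (decrement (c + 1) (c + 2)))).Runs o x y ∧
        J' (k + 1) y := by
    rintro k hk x ⟨h0, h1, hJx⟩
    obtain ⟨y, hxy, y0, y1, hJy⟩ := hstep k hk x h0 hJx
    refine ⟨_, hxy.trans ((increment_runs (by simp) _).trans (decrement_runs (by simp) _)),
      ?_, ?_, hJ _ y _ (fun r hr => ?_) hJy⟩
    · simp [y0, h0]
    · simp [y1, h1, sub_sub]
    · rw [Function.update_of_ne (by omega), Function.update_of_ne (by omega),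
        Function.update_of_ne (by omega), Function.update_of_ne (by omega)]
  have hinit : J' 0 (Function.update (Function.update x c (0 : ℚ)) (c + 1)
      (Function.update x c ((0 : ℚ) : ℝ) s)) := by
    refine ⟨by simp, by simp [hs.ne, hn], hJ _ x _ (fun r hr => ?_) hx⟩
    rw [Function.update_of_ne (by omega), Function.update_of_ne (by omega)]
  obtain ⟨y, hy, h0, -, hJy⟩ := exists_runs_whilePos (fun k x hk => hk.2.1) hstep' hinit
  exact ⟨y, (Runs.const c 0 x).trans ((move_runs (by omega) _).trans hy), h0, hJy⟩

end RealProgram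

/-- A function of the oracle and of natural numbers is computed by machines over the reals, with
the arguments in registers `ins i` and the value in the register `o`. The machine writes to no
register outside a range `[o, R)`, so that the inputs survive. -/
def RealComputable {n : ℕ} (f : (ℕ → ℂ) → List.Vector ℕ n → ℝ) : Prop :=
  ∀ (ins : Fin n → ℕ) (o : ℕ), (∀ i, ins i < o) → ∃ (p : RealProgram) (R : ℕ),
    ∀ (orc : ℕ → ℂ) (x : ℕ → ℝ) (v : List.Vector ℕ n), (∀ i, x (ins i) = v.get i) →
      ∃ y, p.Runs orc x y ∧ y o = f orc v ∧ ∀ r, r < o ∨ R ≤ r → y r = x r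

/-- The bit carried by an answer of the oracle. The threshold `1/2` makes it robust: answers `0` and
`1` that are known up to an error below `1/2` carry the bits `0` and `1`. -/
noncomputable def answerBit (z : ℂ) : Bool :=
  decide (1 / 2 < z.re)

namespace RealComputable

open RealProgram

theorem zero {n : ℕ} : RealComputable fun _ (_ : List.Vector ℕ n) => 0 := fun _ o _ =>
  ⟨.const o 0, o + 1, fun _ x _ _ => ⟨_, .const o 0 x, by simp,
    fun r hr => Function.update_of_ne (by omega) _ _⟩⟩

theorem succ : RealComputable fun _ (v : List.Vector ℕ 1) => (v.head.succ : ℝ) := by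
  intro ins o ho
  refine ⟨.seq (.const o 1) (.add o (ins 0) o), o + 1, fun orc x v hv =>
    ⟨_, (Runs.const o 1 x).trans (.add o (ins 0) o _), ?_, fun r hr => ?_⟩⟩
  · simp [(ho 0).ne, hv, List.Vector.get_zero]
  · rw [Function.update_of_ne (by omega), Function.update_of_ne (by omega)]

theorem get {n : ℕ} (i : Fin n) : RealComputable fun _ (v : List.Vector ℕ n) => (v.get i : ℝ) :=
  fun ins o ho => ⟨move o (ins i), o + 1, fun _ x v hv =>
    ⟨_, move_runs (ho i).ne x, by simp [hv], fun r hr => Function.update_of_ne (by omega) _ _⟩⟩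

theorem oracleBit : RealComputable fun orc (v : List.Vector ℕ 1) =>
    ((answerBit (orc v.head)).toNat : ℝ) := by
  intro ins o _
  refine ⟨.seq (.query o (o + 1) (ins 0)) (.seq (.const (o + 1) (1 / 2))
    (.seq (.sub o o (o + 1)) (.ifPos o (.const o 1) (.const o 0)))), o + 2, fun orc x v hv => ?_⟩
  set y := Function.update (Function.update x o (orc v.head).re) (o + 1) (orc v.head).im
  set z := Function.update y (o + 1) ((1 / 2 : ℚ) : ℝ)
  set w := Function.update z o (z o - z (o + 1))
  have hw : w o = (orc v.head).re - 1 / 2 := by simp [w, z, y]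
  have hwr : ∀ r, r < o ∨ o + 2 ≤ r → w r = x r := fun r hr => by
    simp only [w, z, y]
    rw [Function.update_of_ne (by omega), Function.update_of_ne (by omega),
      Function.update_of_ne (by omega), Function.update_of_ne (by omega)]
  have hxw {p : RealProgram} {u : ℕ → ℝ} (hp : p.Runs orc w u) := (Runs.query o (o + 1) (ins 0)
    v.head x (by rw [hv, List.Vector.get_zero])).trans ((Runs.const (o + 1) (1 / 2) y).trans
      ((Runs.sub o o (o + 1) z).trans hp))
  by_cases h : 1 / 2 < (orc v.head).re
  · refine ⟨_, hxw (.ifTrue _ _ _ _ _ (hw ▸ sub_pos.2 h) (.const o 1 w)),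
      by simp only [Function.update_self, answerBit, decide_eq_true h, Bool.toNat_true]; simp,
      fun r hr => ?_⟩
    rw [Function.update_of_ne (by omega), hwr r hr]
  · refine ⟨_, hxw (.ifFalse _ _ _ _ _ (hw ▸ sub_nonpos.2 (not_lt.1 h)) (.const o 0 w)),
      by simp only [Function.update_self, answerBit, decide_eq_false h, Bool.toNat_false]; simp,
      fun r hr => ?_⟩
    rw [Function.update_of_ne (by omega), hwr r hr]

theorem exists_program_tuple {n m : ℕ} {g : Fin m → (ℕ → ℂ) → List.Vector ℕ n → ℝ}
    (hg : ∀ i, RealComputable (g i)) (ins : Fin n → ℕ) (o : ℕ) (ho : ∀ i, ins i < o) :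
    ∃ (p : RealProgram) (R : ℕ), ∀ (orc : ℕ → ℂ) (x : ℕ → ℝ) (v : List.Vector ℕ n),
      (∀ i, x (ins i) = v.get i) →
        ∃ y, p.Runs orc x y ∧ (∀ i : Fin m, y (o + i) = g i orc v) ∧
          ∀ r, r < o ∨ R ≤ r → y r = x r := by
  induction m with
  | zero =>
    exact ⟨.const o 0, o + 1, fun _ x _ _ => ⟨_, .const o 0 x, fun i => i.elim0,
      fun r hr => Function.update_of_ne (by omega) _ _⟩⟩
  | succ m ih =>
    obtain ⟨p, R, hp⟩ := ih fun i => hg i.castSucc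
    obtain ⟨q, R', hq⟩ := hg (Fin.last m) ins (o + m) fun i => (ho i).trans_le (by omega)
    refine ⟨.seq p q, max R R', fun orc x v hv => ?_⟩
    obtain ⟨y, hxy, hy, hyr⟩ := hp orc x v hv
    obtain ⟨z, hyz, hz, hzr⟩ := hq orc y v fun i => by rw [hyr _ (.inl (ho i)), hv]
    refine ⟨z, hxy.trans hyz, fun i => ?_, fun r hr => ?_⟩
    · induction i using Fin.lastCases with
      | last => exact hz
      | cast i => exact (hzr _ (.inl (by simp))).trans (hy i)
    · rw [hzr r (by omega), hyr r (by omega)]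

theorem comp {m n : ℕ} {f : (ℕ → ℂ) → List.Vector ℕ n → ℝ}
    {g : Fin n → (ℕ → ℂ) → List.Vector ℕ m → ℕ} (hf : RealComputable f)
    (hg : ∀ i, RealComputable fun orc v => (g i orc v : ℝ)) :
    RealComputable fun orc v => f orc (List.Vector.ofFn fun i => g i orc v) := by
  intro ins o ho
  obtain ⟨p, R, hp⟩ := exists_program_tuple hg ins (o + 1) fun i => (ho i).trans (by simp)
  obtain ⟨q, R', hq⟩ := hf (fun i => o + 1 + i) (o + 1 + n) (fun i => by simp)
  refine ⟨.seq p (.seq q (move o (o + 1 + n))), max (max R R') (o + 1), fun orc x v hv => ?_⟩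
  obtain ⟨y, hxy, hy, hyr⟩ := hp orc x v hv
  obtain ⟨z, hyz, hz, hzr⟩ := hq orc y (List.Vector.ofFn fun i => g i orc v)
    fun i => by rw [hy, List.Vector.get_ofFn]
  refine ⟨_, hxy.trans (hyz.trans (move_runs (by omega) z)), by simp [hz], fun r hr => ?_⟩
  rw [Function.update_of_ne (by omega), hzr r (by omega), hyr r (by omega)]

theorem prec {n : ℕ} {f : (ℕ → ℂ) → List.Vector ℕ n → ℕ}
    {g : (ℕ → ℂ) → List.Vector ℕ (n + 2) → ℕ} (hf : RealComputable fun orc v => (f orc v : ℝ))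
    (hg : RealComputable fun orc v => (g orc v : ℝ)) :
    RealComputable fun orc (v : List.Vector ℕ (n + 1)) =>
      ((v.head.rec (f orc v.tail) fun y IH => g orc (y ::ᵥ IH ::ᵥ v.tail) : ℕ) : ℝ) := by
  intro ins o ho
  -- the value is kept in `o`, the loop uses `o + 1`, `o + 2`, `o + 3`, and `g` is put into `o + 4`
  obtain ⟨p, R, hp⟩ := hf (fun i => ins i.succ) o fun i => ho _
  obtain ⟨q, R', hq⟩ := hg (Fin.cons (o + 1) (Fin.cons o fun i => ins i.succ)) (o + 4)
    (Fin.cases (by simp) (Fin.cases (by simp) fun i => (ho i.succ).trans_le (by simp)))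
  refine ⟨.seq p (forLoop (o + 1) (ins 0) (.seq q (move o (o + 4)))), max (max R R') (o + 5),
    fun orc x v hv => ?_⟩
  let value (k : ℕ) : ℕ :=
    k.rec (motive := fun _ => ℕ) (f orc v.tail) fun y IH => g orc (y ::ᵥ IH ::ᵥ v.tail)
  let J (k : ℕ) (s : ℕ → ℝ) : Prop :=
    s o = (value k : ℝ) ∧ ∀ r, r < o ∨ max (max R R') (o + 5) ≤ r → s r = x r
  have hstep : ∀ k < v.head, ∀ s, s (o + 1) = (k : ℝ) → J k s →
      ∃ t, (RealProgram.seq q (move o (o + 4))).Runs orc s t ∧ t (o + 1) = s (o + 1) ∧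
        t (o + 1 + 1) = s (o + 1 + 1) ∧ J (k + 1) t := by
    rintro k - s hk ⟨hso, hsr⟩
    obtain ⟨t, hst, ht, htr⟩ := hq orc s (k ::ᵥ value k ::ᵥ v.tail)
      (Fin.cases (by simpa using hk) (Fin.cases hso fun i => by
        simp [hsr _ (.inl (ho _)), hv, List.Vector.get_tail_succ]))
    refine ⟨_, hst.trans (move_runs (by simp) t), ?_, ?_, by simp [ht, value], fun r hr => ?_⟩
    · rw [Function.update_of_ne (by omega), htr _ (by omega)]
    · rw [Function.update_of_ne (by omega), htr _ (by omega)]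
    · rw [Function.update_of_ne (by omega), htr r (by omega), hsr r hr]
  obtain ⟨y, hxy, hy, hyr⟩ := hp orc x v.tail fun i => by rw [hv, List.Vector.get_tail_succ]
  obtain ⟨z, hyz, -, hz, hzr⟩ := exists_runs_forLoop ((ho 0).trans_le (by simp)) (J := J)
    (fun k s t hst hs => ⟨by rw [hst o (by omega), hs.1],
      fun r hr => by rw [hst r (by omega), hs.2 r hr]⟩) hstep
    ⟨hy, fun r hr => hyr r (by omega)⟩
    (by rw [hyr _ (.inl (ho 0)), hv, List.Vector.get_zero])
  exact ⟨z, hxy.trans hyz, hz, fun r hr => hzr r (by omega)⟩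

theorem of_primrec {n : ℕ} {f : List.Vector ℕ n → ℕ} (hf : Primrec f) :
    RealComputable fun _ v => (f v : ℝ) := by
  have h := Nat.Primrec'.of_prim hf
  clear hf
  induction h with
  | zero => simpa using zero
  | succ => exact succ
  | get i => exact get i
  | comp _ _ _ ihf ihg => exact ihf.comp ihg
  | prec _ _ ihf ihg => exact ihf.prec ihg

theorem comp_cons {n : ℕ} {F : List.Vector ℕ (n + 1) → ℕ} (hF : Primrec F)
    {g : (ℕ → ℂ) → List.Vector ℕ n → ℕ} (hg : RealComputable fun orc v => (g orc v : ℝ)) :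
    RealComputable fun orc v => (F (g orc v ::ᵥ v) : ℝ) := by
  have h (orc : ℕ → ℂ) (v : List.Vector ℕ n) : g orc v ::ᵥ v =
      List.Vector.ofFn fun i => Fin.cons (α := fun _ => (ℕ → ℂ) → List.Vector ℕ n → ℕ) g
        (fun i _ v => v.get i) i orc v := by
    rw [← List.Vector.ofFn_get (g orc v ::ᵥ v)]
    congr 1
    ext i
    induction i using Fin.cases <;> simp
  simp only [h]
  exact (of_primrec hF).comp (Fin.cases hg get)

theorem exists_program_pair {n : ℕ} {f g : (ℕ → ℂ) → List.Vector ℕ n → ℝ}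
    (hf : RealComputable f) (hg : RealComputable g) (ins : Fin n → ℕ) (o : ℕ)
    (ho : ∀ i, ins i < o) :
    ∃ (p : RealProgram) (R : ℕ), ∀ (orc : ℕ → ℂ) (x : ℕ → ℝ) (v : List.Vector ℕ n),
      (∀ i, x (ins i) = v.get i) →
        ∃ y, p.Runs orc x y ∧ y o = f orc v ∧ y (o + 1) = g orc v ∧
          ∀ r, r < o ∨ R ≤ r → y r = x r := by
  obtain ⟨p, R, hp⟩ := exists_program_tuple (g := ![f, g])
    (Fin.forall_fin_two.2 ⟨hf, hg⟩) ins o ho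
  refine ⟨p, R, fun orc x v hv => ?_⟩
  obtain ⟨y, hxy, hy, hyr⟩ := hp orc x v hv
  exact ⟨y, hxy, hy 0, hy 1, hyr⟩

theorem sub {n : ℕ} {f g : (ℕ → ℂ) → List.Vector ℕ n → ℝ} (hf : RealComputable f)
    (hg : RealComputable g) : RealComputable fun orc v => f orc v - g orc v := by
  intro ins o ho
  obtain ⟨p, R, hp⟩ := exists_program_pair hf hg ins o ho
  refine ⟨.seq p (.sub o o (o + 1)), max R (o + 1), fun orc x v hv => ?_⟩
  obtain ⟨y, hxy, hf, hg, hyr⟩ := hp orc x v hv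
  refine ⟨_, hxy.trans (.sub _ _ _ _), by simp [hf, hg], fun r hr => ?_⟩
  rw [Function.update_of_ne (by omega), hyr r (by omega)]

theorem div {n : ℕ} {f g : (ℕ → ℂ) → List.Vector ℕ n → ℝ} (hf : RealComputable f)
    (hg : RealComputable g) (h0 : ∀ orc v, g orc v ≠ 0) :
    RealComputable fun orc v => f orc v / g orc v := by
  intro ins o ho
  obtain ⟨p, R, hp⟩ := exists_program_pair hf hg ins o ho
  refine ⟨.seq p (.div o o (o + 1)), max R (o + 1), fun orc x v hv => ?_⟩
  obtain ⟨y, hxy, hf, hg, hyr⟩ := hp orc x v hv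
  refine ⟨_, hxy.trans (.div _ _ _ _ (hg ▸ h0 orc v)), by simp [hf, hg], fun r hr => ?_⟩
  rw [Function.update_of_ne (by omega), hyr r (by omega)]

end RealComputable

/-! ## Output of finite sets of points -/

namespace RealProgram

open RealComputable

variable {o : ℕ → ℂ}

/-- Copies the point in the registers `B` and `B + 1` to the places `0, …, k` of the output. -/
def copyPoint (B : ℕ) : ℕ → RealProgram
  | 0 => .seq (move 1 B) (move 2 (B + 1))
  | k + 1 => .seq (copyPoint B k) (.seq (move (2 * k + 3) B) (move (2 * k + 4) (B + 1)))

theorem exists_runs_copyPoint {B k : ℕ} (hB : 2 * k + 2 < B) (x : ℕ → ℝ) :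
    ∃ y, (copyPoint B k).Runs o x y ∧
      (∀ i ≤ k, y (2 * i + 1) = x B ∧ y (2 * i + 2) = x (B + 1)) ∧
        ∀ r, r < 1 ∨ 2 * k + 3 ≤ r → y r = x r := by
  induction k with
  | zero =>
    refine ⟨_, (move_runs (by omega) x).trans (move_runs (by omega) _), ?_, fun r hr => ?_⟩
    · simp [Function.update_of_ne (show B + 1 ≠ 1 by omega)]
    · rw [Function.update_of_ne (by omega), Function.update_of_ne (by omega)]
  | succ k ih =>
    obtain ⟨y, hxy, hy, hyr⟩ := ih (by omega)
    refine ⟨_, hxy.trans ((move_runs (by omega) y).trans (move_runs (by omega) _)),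
      fun i hi => ?_, fun r hr => ?_⟩
    · rcases Nat.le_succ_iff.1 hi with h | rfl
      · rw [Function.update_of_ne (by omega), Function.update_of_ne (by omega),
          Function.update_of_ne (by omega), Function.update_of_ne (by omega)]
        exact hy i h
      · have hB1 : B + 1 ≠ 2 * k + 3 := by omega
        simp [Nat.mul_succ, Function.update_of_ne hB1, hyr B (by omega), hyr (B + 1) (by omega)]
    · rw [Function.update_of_ne (by omega), Function.update_of_ne (by omega), hyr r (by omega)]

theorem exists_program_store {n : ℕ} {f : (ℕ → ℂ) → List.Vector ℕ n → ℝ} (hf : RealComputable f)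
    (ins : Fin n → ℕ) (a w : ℕ) (haw : a < w) (hw : ∀ i, ins i < w) :
    ∃ (p : RealProgram) (R : ℕ), ∀ (orc : ℕ → ℂ) (x : ℕ → ℝ) (v : List.Vector ℕ n) (m : ℕ),
      (∀ i, x (ins i) = v.get i) → x a = m → R ≤ m → ∃ y, p.Runs orc x y ∧ y m = f orc v ∧
        y a = (m + 1 : ℕ) ∧ ∀ r, r < w ∨ R ≤ r → r ≠ a → r ≠ m → y r = x r := by
  obtain ⟨p, R, hp⟩ := hf ins w hw
  refine ⟨.seq p (.seq (.store a w) (increment a w)), max R (w + 1),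
    fun orc x v m hv ha hm => ?_⟩
  obtain ⟨y, hxy, hy, hyr⟩ := hp orc x v hv
  refine ⟨_, hxy.trans ((Runs.store a w m y (by rw [hyr a (.inl haw), ha])).trans
    (increment_runs haw.ne _)), ?_, ?_, fun r hr hra hrm => ?_⟩
  · rw [Function.update_of_ne (by omega), Function.update_of_ne (by omega), Function.update_self,
      hy]
  · rw [Function.update_self, Function.update_of_ne (by omega), hyr a (.inl haw), ha]
    push_cast
    rfl
  · rw [Function.update_of_ne hra, Function.update_of_ne (by omega), Function.update_of_ne hrm,
      hyr r (by omega)]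

section

variable {k : ℕ} {len : (ℕ → ℂ) → List.Vector ℕ k → ℕ}
  {re im : (ℕ → ℂ) → List.Vector ℕ (k + 1) → ℝ}

theorem exists_program_storePoint (hre : RealComputable re) (him : RealComputable im) :
    ∃ (p : RealProgram) (R : ℕ), ∀ (orc : ℕ → ℂ) (x : ℕ → ℝ) (v : List.Vector ℕ k) (i m : ℕ),
      (∀ j : Fin k, x j = v.get j) → x (k + 1) = m → x (k + 2) = i → R ≤ m →
        ∃ y, p.Runs orc x y ∧ y m = re orc (i ::ᵥ v) ∧ y (m + 1) = im orc (i ::ᵥ v) ∧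
          y (k + 1) = (m + 2 : ℕ) ∧
            ∀ r, r < k + 5 ∨ R ≤ r → r ≠ k + 1 → r ≠ m → r ≠ m + 1 → y r = x r := by
  have hins : ∀ j, (Fin.cons (k + 2) fun j : Fin k => (j : ℕ) : Fin (k + 1) → ℕ) j < k + 5 :=
    Fin.cases (by simp) fun j => j.2.trans (by simp)
  obtain ⟨p, R, hp⟩ := exists_program_store hre _ (k + 1) (k + 5) (by simp) hins
  obtain ⟨q, R', hq⟩ := exists_program_store him _ (k + 1) (k + 5) (by simp) hins
  refine ⟨.seq p q, max (max R R') (k + 5), fun orc x v i m hv ha hi hm => ?_⟩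
  have hx : ∀ j, x ((Fin.cons (k + 2) fun j : Fin k => (j : ℕ) : Fin (k + 1) → ℕ) j) =
      (i ::ᵥ v).get j := Fin.cases (by simpa using hi) fun j => by simpa using hv j
  obtain ⟨y, hxy, hy, hya, hyr⟩ := hp orc x (i ::ᵥ v) m hx ha (by omega)
  have hyx : ∀ r, r < k + 5 → r ≠ k + 1 → y r = x r := fun r hr hra =>
    hyr r (.inl hr) hra (by omega)
  have hins' : ∀ j, (Fin.cons (k + 2) fun j : Fin k => (j : ℕ) : Fin (k + 1) → ℕ) j ≠ k + 1 :=
    Fin.cases (by simp) fun j => (j.2.trans (by simp)).ne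
  obtain ⟨z, hyz, hz, hza, hzr⟩ := hq orc y (i ::ᵥ v) (m + 1)
    (fun j => by rw [hyx _ (hins j) (hins' j), hx]) hya (by omega)
  refine ⟨z, hxy.trans hyz, ?_, hz, hza, fun r hr hra hrm hrm' => ?_⟩
  · rw [hzr m (by omega) (by omega) (by omega), hy]
  · rw [hzr r (by omega) hra hrm', hyr r (by omega) hra hrm]

/-- The registers `0, …, k - 1` hold the input, `k` the number of points, `k + 1` the address of the
next point, and `k + 2`, `k + 3`, `k + 4` belong to the loop. -/
theorem exists_program_storePoints (hlen : RealComputable fun orc v => (len orc v : ℝ))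
    (hre : RealComputable re) (him : RealComputable im) :
    ∃ R : ℕ, ∀ B, R ≤ B → ∃ p : RealProgram, ∀ (orc : ℕ → ℂ) (x : ℕ → ℝ) (v : List.Vector ℕ k),
      (∀ j : Fin k, x j = v.get j) → ∃ y, p.Runs orc x y ∧ y (k + 2) = len orc v ∧
        ∀ i < len orc v, y (B + 2 * i) = re orc (i ::ᵥ v) ∧
          y (B + 2 * i + 1) = im orc (i ::ᵥ v) := by
  obtain ⟨p, R, hp⟩ := hlen (fun j => j) k fun j => j.2
  obtain ⟨q, R', hq⟩ := exists_program_storePoint hre him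
  refine ⟨max (max R R') (k + 5), fun B hB =>
    ⟨.seq p (.seq (.const (k + 1) B) (forLoop (k + 2) k q)), fun orc x v hv => ?_⟩⟩
  let J (i : ℕ) (s : ℕ → ℝ) : Prop := (∀ j : Fin k, s j = v.get j) ∧ s (k + 1) = (B + 2 * i : ℕ) ∧
    ∀ j < i, s (B + 2 * j) = re orc (j ::ᵥ v) ∧ s (B + 2 * j + 1) = im orc (j ::ᵥ v)
  have hstep : ∀ i < len orc v, ∀ s, s (k + 2) = (i : ℝ) → J i s → ∃ t, q.Runs orc s t ∧
      t (k + 2) = s (k + 2) ∧ t (k + 2 + 1) = s (k + 2 + 1) ∧ J (i + 1) t := by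
    rintro i - s hi ⟨hsv, hsa, hs⟩
    obtain ⟨t, hst, htre, htim, hta, htr⟩ := hq orc s v i _ hsv hsa hi (by omega)
    refine ⟨t, hst, htr _ (by omega) (by omega) (by omega) (by omega),
      htr _ (by omega) (by omega) (by omega) (by omega), fun j => ?_, hta, fun j hj => ?_⟩
    · rw [htr j (by omega) (by omega) (by omega) (by omega), hsv]
    · rcases Nat.lt_succ_iff_lt_or_eq.1 hj with h | rfl
      · rw [htr _ (by omega) (by omega) (by omega) (by omega),
          htr _ (by omega) (by omega) (by omega) (by omega)]
        exact hs j h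
      · exact ⟨htre, htim⟩
  obtain ⟨y, hxy, hy, hyr⟩ := hp orc x v hv
  have hinit : J 0 (Function.update y (k + 1) ((B : ℚ) : ℝ)) :=
    ⟨fun j => by rw [Function.update_of_ne (by omega), hyr j (by omega), hv], by simp, by simp⟩
  have hJ : ∀ i s t, (∀ r, r < k + 2 ∨ k + 2 + 3 ≤ r → t r = s r) → J i s → J i t := by
    rintro i s t hst ⟨hsv, hsa, hs⟩
    refine ⟨fun j => by rw [hst j (by omega), hsv], by rw [hst _ (by omega), hsa], fun j hj => ?_⟩
    rw [hst _ (by omega), hst _ (by omega)]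
    exact hs j hj
  obtain ⟨z, hyz, hz, -, -, hzpts⟩ :=
    exists_runs_forLoop (by omega : k < k + 2) hJ hstep hinit (by simp [hy])
  exact ⟨z, hxy.trans ((Runs.const (k + 1) B y).trans hyz), hz, hzpts⟩

/-- The low registers are needed for the computation, so the output is written to high registers,
and the places below are filled with copies of the first point. -/
theorem exists_program_output (hlen : RealComputable fun orc v => (len orc v : ℝ))
    (hpos : ∀ orc v, 0 < len orc v) (hre : RealComputable re) (him : RealComputable im) :
    ∃ (p : RealProgram) (M : ℕ), ∀ (orc : ℕ → ℂ) (x : ℕ → ℝ) (v : List.Vector ℕ k),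
      (∀ j : Fin k, x j = v.get j) → ∃ y, p.Runs orc x y ∧ y 0 = (len orc v + M : ℕ) ∧
        ∀ i < len orc v + M, y (2 * i + 1) = re orc ((i - M) ::ᵥ v) ∧
          y (2 * i + 2) = im orc ((i - M) ::ᵥ v) := by
  obtain ⟨R, hR⟩ := exists_program_storePoints hlen hre him
  obtain ⟨N, hN⟩ : ∃ N, R + k + 1 = N := ⟨_, rfl⟩
  obtain ⟨p, hp⟩ := hR (2 * N + 3) (by omega)
  refine ⟨.seq p (.seq (.const (k + 3) (N + 1 : ℕ)) (.seq (.add 0 (k + 2) (k + 3))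
    (copyPoint (2 * N + 3) N))), N + 1, fun orc x v hv => ?_⟩
  obtain ⟨y, hxy, hylen, hy⟩ := hp orc x v hv
  let s := Function.update y (k + 3) (((N + 1 : ℕ) : ℚ) : ℝ)
  let t := Function.update s 0 (s (k + 2) + s (k + 3))
  have hty : ∀ r, 2 * N + 3 ≤ r → t r = y r := fun r hr => by
    simp only [t, s]
    rw [Function.update_of_ne (by omega), Function.update_of_ne (by omega)]
  obtain ⟨z, htz, hzcopy, hzr⟩ := exists_runs_copyPoint (o := orc) (k := N) (B := 2 * N + 3)
    (by omega) t
  refine ⟨z, hxy.trans ((Runs.const _ _ y).trans ((Runs.add _ _ _ s).trans htz)), ?_,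
    fun i hi => ?_⟩
  · rw [hzr 0 (by simp)]
    simp [t, s, hylen]
  · rcases le_or_gt i N with h | h
    · rw [(hzcopy i h).1, (hzcopy i h).2, hty _ le_rfl, hty _ (by simp),
        Nat.sub_eq_zero_of_le (by omega)]
      exact hy 0 (hpos orc v)
    · obtain ⟨j, rfl⟩ := Nat.exists_eq_add_of_le' h
      rw [hzr _ (by omega), hzr _ (by omega), hty _ (by omega), hty _ (by omega),
        Nat.add_sub_cancel, show 2 * (j + (N + 1)) + 1 = 2 * N + 3 + 2 * j by ring,
        show 2 * (j + (N + 1)) + 2 = 2 * N + 3 + 2 * j + 1 by ring]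
      exact hy j (by omega)

end

end RealProgram

/-! ## Algorithms that read finitely many bits -/

/-- The first `n` terms of a sequence of bits. -/
def window (b : ℕ → Bool) (n : ℕ) : List Bool :=
  (List.range n).map b

theorem window_congr {b b' : ℕ → Bool} {n : ℕ} (h : ∀ k < n, b k = b' k) :
    window b n = window b' n :=
  List.map_congr_left fun k hk => h k (List.mem_range.1 hk)

/-- Appends a bit to the list of bits with code `w`, on the level of codes. -/
def appendBit (w : ℕ) (b : Bool) : ℕ :=
  Encodable.encode ((Encodable.decode (α := List Bool) w).getD [] ++ [b])

theorem appendBit_encode_window (b : ℕ → Bool) (n : ℕ) :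
    appendBit (Encodable.encode (window b n)) (b n) = Encodable.encode (window b (n + 1)) := by
  simp [appendBit, window, List.range_succ]

theorem primrec_appendBit : Primrec₂ appendBit :=
  Primrec.encode.comp (Primrec.list_concat.comp
    (Primrec.option_getD.comp (Primrec.decode.comp Primrec.fst) (Primrec.const [])) Primrec.snd)

theorem gaussOfCode_re (c : GaussCode) : (gaussOfCode c).re = ratOfCode c.1 := by
  simp [gaussOfCode]

theorem gaussOfCode_im (c : GaussCode) : (gaussOfCode c).im = ratOfCode c.2 := by
  simp [gaussOfCode]

/-- The bits `β A k` that algorithms read are carried by evaluations of `A`, at computable indices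
`q k`. -/
structure IsBinaryModel {Ω I : Type} [Encodable I] (P : ComputationalProblem Ω I)
    (β : Ω → ℕ → Bool) (q : ℕ → I) : Prop where
  primrec : Primrec fun k => Encodable.encode (q k)
  bit : ∀ A k, answerBit (P.eval A (q k)) = β A k

/-- With the parameters `l`, the algorithm reads the first `size l` bits of the input, and its
output is the list of points that `out` computes from `l` and these bits. -/
def IsWindowOutput {Ω : Type} (β : Ω → ℕ → Bool) (size : List ℕ → ℕ)
    (out : List ℕ × List Bool → List GaussCode) (k : ℕ) (Γ : List ℕ → Ω → HausdorffSpace) : Prop :=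
  ∀ l : List ℕ, l.length = k → ∀ A,
    (Γ l A : Set ℂ) = {z | ∃ c ∈ out (l, window (β A) (size l)), gaussOfCode c = z}

section

variable {Ω I : Type} [Encodable I] {P : ComputationalProblem Ω I} {β : Ω → ℕ → Bool} {q : ℕ → I}
  {size : List ℕ → ℕ} {out : List ℕ × List Bool → List GaussCode} {k : ℕ}
  {Γ : List ℕ → Ω → HausdorffSpace}

theorem IsBinaryModel.isGeneralAlgorithm (hP : IsBinaryModel P β q)
    (hΓ : IsWindowOutput β size out k Γ) {l : List ℕ} (hl : l.length = k) :
    IsGeneralAlgorithm P (Γ l) := by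
  classical
  refine ⟨fun _ => (Finset.range (size l + 1)).image q, fun A =>
    ⟨Finset.nonempty_range_add_one.image _, fun B hB => ⟨rfl, SetLike.coe_injective ?_⟩⟩⟩
  have hbit : ∀ i < size l, β A i = β B i := fun i hi => by
    rw [← hP.bit, ← hP.bit,
      hB (q i) (Finset.mem_image_of_mem _ (Finset.mem_range.2 (by omega)))]
  rw [hΓ l hl, hΓ l hl, window_congr hbit]

end

namespace RecursiveFunctional

theorem of_eq {f h : (ℕ → ℕ) → ℕ →. ℕ} (hf : RecursiveFunctional f)
    (H : ∀ g n, f g n = h g n) : RecursiveFunctional h :=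
  (funext₂ H : f = h) ▸ hf

theorem of_primrec {f : ℕ → ℕ} (hf : Primrec f) :
    RecursiveFunctional fun _ n => Part.some (f n) := by
  have h := Primrec.nat_iff.1 hf
  clear hf
  induction h with
  | zero => exact zero
  | succ => exact succ
  | left => exact left
  | right => exact right
  | pair _ _ ihf ihg => exact (pair ihf ihg).of_eq fun _ _ => by simp [Seq.seq]
  | comp _ _ ihf ihg => exact (comp ihf ihg).of_eq fun _ _ => by simp
  | prec _ _ ihf ihg =>
    refine (prec ihf ihg).of_eq fun _ n => ?_
    simp only [Nat.unpaired]
    induction n.unpair.2 with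
    | zero => rfl
    | succ m ih =>
      dsimp only at ih ⊢
      rw [ih]
      simp

theorem comp_some {f h : (ℕ → ℕ) → ℕ → ℕ}
    (hf : RecursiveFunctional fun g n => Part.some (f g n))
    (hh : RecursiveFunctional fun g n => Part.some (h g n)) :
    RecursiveFunctional fun g n => Part.some (f g (h g n)) :=
  (comp hf hh).of_eq fun _ _ => by simp

theorem pair_some {f h : (ℕ → ℕ) → ℕ → ℕ}
    (hf : RecursiveFunctional fun g n => Part.some (f g n))
    (hh : RecursiveFunctional fun g n => Part.some (h g n)) :
    RecursiveFunctional fun g n => Part.some (Nat.pair (f g n) (h g n)) :=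
  (pair hf hh).of_eq fun _ _ => by simp [Seq.seq]

end RecursiveFunctional

/-- The version of `answerBit` for the answers on an oracle tape. -/
def codeBit (m : ℕ) : Bool :=
  ((Encodable.decode m : Option GaussCode).map fun c =>
    decide (2 * c.1.2.1 + c.1.2.2 + 1 < 2 * c.1.1)).getD false

theorem primrec_codeBit : Primrec codeBit := by
  refine Primrec.option_getD.comp (Primrec.option_map Primrec.decode ?_) (Primrec.const false)
  refine PrimrecPred.decide (Primrec.nat_lt.comp ?_ ?_)
  · exact Primrec.succ.comp (Primrec.nat_add.comp (Primrec.nat_double.comp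
      (Primrec.fst.comp (Primrec.snd.comp (Primrec.fst.comp Primrec.snd))))
      (Primrec.snd.comp (Primrec.snd.comp (Primrec.fst.comp Primrec.snd))))
  · exact Primrec.nat_double.comp (Primrec.fst.comp (Primrec.fst.comp Primrec.snd))

theorem codeBit_encode (c : GaussCode) :
    codeBit (Encodable.encode c) = answerBit (gaussOfCode c) := by
  rw [answerBit, gaussOfCode_re, codeBit, Encodable.encodek, ratOfCode]
  simp only [Option.map_some, Option.getD_some, decide_eq_decide]
  push_cast
  rw [lt_div_iff₀ (by positivity), ← Nat.cast_lt (α := ℝ)]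
  push_cast
  constructor <;> intro h <;> linarith

theorem recursiveFunctional_window {r : ℕ → ℕ} (hr : Primrec r) :
    RecursiveFunctional fun g n =>
      Part.some (Encodable.encode (window (fun k => codeBit (g (r k))) n)) := by
  have hfst : Primrec fun n : ℕ => n.unpair.1 := Primrec.fst.comp Primrec.unpair
  have hsnd : Primrec fun n : ℕ => n.unpair.2 := Primrec.snd.comp Primrec.unpair
  have happend : Primrec fun m : ℕ => appendBit m.unpair.1.unpair.2.unpair.2 (codeBit m.unpair.2) :=
    primrec_appendBit.comp (hsnd.comp (hsnd.comp hfst)) (primrec_codeBit.comp hsnd)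
  have hstep := (RecursiveFunctional.of_primrec happend).comp_some
    ((RecursiveFunctional.of_primrec Primrec.id).pair_some
      (RecursiveFunctional.oracle.comp_some
        (RecursiveFunctional.of_primrec (hr.comp (hfst.comp hsnd)))))
  have hinput := RecursiveFunctional.of_primrec
    (Primrec₂.natPair.comp (Primrec.const 0) Primrec.id : Primrec fun n : ℕ => Nat.pair 0 n)
  have hinit := RecursiveFunctional.of_primrec
    (Primrec.const (Encodable.encode (window (fun _ => false) 0)))
  refine ((hinit.prec hstep).comp hinput).of_eq fun g n => ?_
  simp only [Part.bind_eq_bind, Part.bind_some, Nat.unpair_pair, id_eq]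
  induction n with
  | zero => rfl
  | succ n ih =>
    dsimp only at ih ⊢
    rw [ih, Part.bind_some, appendBit_encode_window (fun k => codeBit (g (r k)))]

theorem IsBinaryModel.isTuringComputable {Ω I : Type} [Encodable I] {P : ComputationalProblem Ω I}
    {β : Ω → ℕ → Bool} {q : ℕ → I} {size : List ℕ → ℕ}
    {out : List ℕ × List Bool → List GaussCode} {k : ℕ} {Γ : List ℕ → Ω → HausdorffSpace}
    (hP : IsBinaryModel P β q) (hΓ : IsWindowOutput β size out k Γ) (hsize : Primrec size)
    (hout : Primrec out) : IsTuringComputable P k Γ := by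
  have hfst : Primrec fun n : ℕ => n.unpair.1 := Primrec.fst.comp Primrec.unpair
  have hsnd : Primrec fun n : ℕ => n.unpair.2 := Primrec.snd.comp Primrec.unpair
  have hparams : Primrec fun m : ℕ => (Encodable.decode m : Option (List ℕ)).getD [] :=
    Primrec.option_getD.comp Primrec.decode (Primrec.const [])
  have hbits : Primrec fun m : ℕ => (Encodable.decode m : Option (List Bool)).getD [] :=
    Primrec.option_getD.comp Primrec.decode (Primrec.const [])
  refine ⟨_, (RecursiveFunctional.of_primrec (Primrec.encode.comp (hout.comp
      ((hparams.comp hfst).pair (hbits.comp hsnd))))).comp_some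
    ((RecursiveFunctional.of_primrec Primrec.id).pair_some
      ((recursiveFunctional_window hP.primrec).comp_some
        (RecursiveFunctional.of_primrec (hsize.comp hparams)))), fun A g hg l hl => ?_⟩
  have hbit : ∀ i, codeBit (g (Encodable.encode (q i))) = β A i := fun i => by
    obtain ⟨c, hgc, hc⟩ := hg (q i)
    rw [hgc, codeBit_encode, hc, hP.bit]
  exact ⟨_, by simp [hbit], hΓ l hl A⟩

namespace RealComputable

theorem comp_window {k : ℕ} {r : ℕ → ℕ} (hr : Primrec r) {size : List.Vector ℕ k → ℕ}
    (hsize : Primrec size) {F : List Bool → List.Vector ℕ k → ℕ} (hF : Primrec₂ F) :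
    RealComputable fun orc v =>
      (F (window (fun i => answerBit (orc (r i))) (size v)) v : ℝ) := by
  let b (orc : ℕ → ℂ) (i : ℕ) : Bool := answerBit (orc (r i))
  have hbit : RealComputable fun orc (v : List.Vector ℕ 2) => ((b orc v.head).toNat : ℝ) := by
    simpa using oracleBit.comp fun _ => of_primrec (hr.comp Primrec.vector_head)
  have happend : RealComputable fun orc (v : List.Vector ℕ 2) =>
      (appendBit v.tail.head (b orc v.head) : ℝ) := by
    have h := comp_cons (F := fun u : List.Vector ℕ 3 => appendBit u.tail.tail.head (u.head == 1))
      (primrec_appendBit.comp (Primrec.vector_head.comp (Primrec.vector_tail.comp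
        Primrec.vector_tail)) (Primrec.beq.comp Primrec.vector_head (Primrec.const 1))) hbit
    refine cast (congrArg _ (funext₂ fun orc v => ?_)) h
    cases b orc v.head <;> simp
  have hwindow : RealComputable fun orc (v : List.Vector ℕ 1) =>
      ((Encodable.encode (window (b orc) v.head) : ℕ) : ℝ) := by
    have h := (of_primrec (Primrec.const (α := List.Vector ℕ 0)
      (Encodable.encode (window (fun _ => false) 0)))).prec happend
    refine cast (congrArg _ (funext₂ fun orc v => congrArg _ ?_)) h
    induction v.head with
    | zero => rfl
    | succ n ih =>
      dsimp only at ih ⊢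
      rw [ih, ← appendBit_encode_window]
      rfl
  have h := comp_cons (F := fun u : List.Vector ℕ (k + 1) =>
      F ((Encodable.decode (α := List Bool) u.head).getD []) u.tail)
    (hF.comp (Primrec.option_getD.comp (Primrec.decode.comp Primrec.vector_head)
      (Primrec.const [])) Primrec.vector_tail)
    (by simpa using hwindow.comp fun _ => of_primrec hsize)
  simpa using h

theorem ratOfCode {k : ℕ} {c : (ℕ → ℂ) → List.Vector ℕ k → ℕ × ℕ × ℕ}
    (h : ∀ F : ℕ × ℕ × ℕ → ℕ, Primrec F → RealComputable fun orc v => (F (c orc v) : ℝ)) :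
    RealComputable fun orc v => (ratOfCode (c orc v) : ℝ) := by
  have hnum := (h _ Primrec.fst).sub (h _ (Primrec.fst.comp Primrec.snd))
  have hden := h _ (Primrec.succ.comp (Primrec.snd.comp Primrec.snd))
  simpa [_root_.ratOfCode] using hnum.div hden fun _ _ => by positivity

end RealComputable

theorem setOf_exists_getD_sub {L : List GaussCode} (hL : L ≠ []) (M : ℕ) :
    {z | ∃ j < L.length + M, z = gaussOfCode (L.getD (j - M) default)} =
      {z | ∃ c ∈ L, gaussOfCode c = z} := by
  ext z
  constructor
  · rintro ⟨j, hj, rfl⟩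
    have hlen : j - M < L.length := by
      have := List.length_pos_iff.2 hL
      omega
    exact ⟨_, by rw [List.getD_eq_getElem _ _ hlen]; exact List.getElem_mem hlen, rfl⟩
  · rintro ⟨c, hc, rfl⟩
    obtain ⟨j, hj, rfl⟩ := List.mem_iff_getElem.1 hc
    exact ⟨j + M, by omega, by rw [Nat.add_sub_cancel, List.getD_eq_getElem]⟩

theorem IsBinaryModel.isBSSComputable {Ω I : Type} [Encodable I] {P : ComputationalProblem Ω I}
    {β : Ω → ℕ → Bool} {q : ℕ → I} {size : List ℕ → ℕ}
    {out : List ℕ × List Bool → List GaussCode} {k : ℕ} {Γ : List ℕ → Ω → HausdorffSpace}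
    (hP : IsBinaryModel P β q) (hΓ : IsWindowOutput β size out k Γ) (hsize : Primrec size)
    (hout : Primrec out) (hne : ∀ x, out x ≠ []) : IsBSSComputable P k Γ := by
  let L (orc : ℕ → ℂ) (v : List.Vector ℕ k) : List GaussCode :=
    out (v.toList, window (fun i => answerBit (orc (Encodable.encode (q i)))) (size v.toList))
  have hlen : RealComputable fun orc v => ((L orc v).length : ℝ) :=
    RealComputable.comp_window hP.primrec (hsize.comp Primrec.vector_toList)
      (F := fun w v => (out (v.toList, w)).length)
      (Primrec.list_length.comp (hout.comp
        ((Primrec.vector_toList.comp Primrec.snd).pair Primrec.fst)))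
  have hget (F : GaussCode → ℕ) (hF : Primrec F) :
      RealComputable fun orc (v : List.Vector ℕ (k + 1)) =>
        (F ((L orc v.tail).getD v.head default) : ℝ) :=
    RealComputable.comp_window hP.primrec
      (hsize.comp (Primrec.vector_toList.comp Primrec.vector_tail))
      (F := fun w v => F ((out (v.tail.toList, w)).getD v.head default))
      (hF.comp ((Primrec.list_getD default).comp (hout.comp
        ((Primrec.vector_toList.comp (Primrec.vector_tail.comp Primrec.snd)).pair Primrec.fst))
        (Primrec.vector_head.comp Primrec.snd)))
  obtain ⟨p, M, hp⟩ := RealProgram.exists_program_output hlen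
    (fun orc v => List.length_pos_iff.2 (hne _))
    (RealComputable.ratOfCode fun F hF => hget _ (hF.comp Primrec.fst))
    (RealComputable.ratOfCode fun F hF => hget _ (hF.comp Primrec.snd))
  refine ⟨p, fun A l hl => ?_⟩
  obtain ⟨y, hy, hN, hpts⟩ := hp (P.realOracle A) (fun r => ((l.getD r 0 : ℕ) : ℝ)) ⟨l, hl⟩
    fun j => by simp [List.Vector.get, hl]
  have hbit : ∀ i, answerBit (P.realOracle A (Encodable.encode (q i))) = β A i := fun i => by
    simp [ComputationalProblem.realOracle, hP.bit]
  have hL : L (P.realOracle A) ⟨l, hl⟩ = out (l, window (β A) (size l)) := by simp [L, hbit]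
  refine ⟨y, _, hy, hN, ?_⟩
  rw [hΓ l hl, ← hL, ← setOf_exists_getD_sub (hne _) M]
  refine Set.ext fun z => exists_congr fun j => and_congr_right fun hj => ?_
  rw [(hpts j hj).1, (hpts j hj).2]
  exact Eq.congr_right (Complex.ext (gaussOfCode_re _) (gaussOfCode_im _))

/-! ## The window test -/

/-- Codes for Gaussian integers: `(a, b, c, d)` stands for `(a - b) + (c - d) i`. The redundancy
turns addition into addition of codes. -/
abbrev IntCode : Type := ℕ × ℕ × ℕ × ℕ

/-- The Gaussian integer with a given code. -/
noncomputable def gaussInt : IntCode →+ ℂ where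
  toFun x := ⟨(x.1 : ℝ) - x.2.1, (x.2.2.1 : ℝ) - x.2.2.2⟩
  map_zero' := by apply Complex.ext <;> simp
  map_add' x y := by apply Complex.ext <;> simp <;> ring

theorem gaussInt_re (x : IntCode) : (gaussInt x).re = (x.1 : ℝ) - x.2.1 := rfl

theorem gaussInt_im (x : IntCode) : (gaussInt x).im = (x.2.2.1 : ℝ) - x.2.2.2 := rfl

namespace IntCode

/-- The negative of a Gaussian integer. -/
def neg (x : IntCode) : IntCode := (x.2.1, x.1, x.2.2.2, x.2.2.1)

/-- The complex conjugate of a Gaussian integer. -/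
def conj (x : IntCode) : IntCode := (x.1, x.2.1, x.2.2.2, x.2.2.1)

/-- The product of two Gaussian integers. -/
def mul (x y : IntCode) : IntCode :=
  (x.1 * y.1 + x.2.1 * y.2.1 + (x.2.2.1 * y.2.2.2 + x.2.2.2 * y.2.2.1),
    x.1 * y.2.1 + x.2.1 * y.1 + (x.2.2.1 * y.2.2.1 + x.2.2.2 * y.2.2.2),
    x.1 * y.2.2.1 + x.2.1 * y.2.2.2 + (x.2.2.1 * y.1 + x.2.2.2 * y.2.1),
    x.1 * y.2.2.2 + x.2.1 * y.2.2.1 + (x.2.2.1 * y.2.1 + x.2.2.2 * y.1))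

/-- The square of the difference of two natural numbers. One of the truncated differences is
zero. -/
def sqDiff (a b : ℕ) : ℕ := (a - b) * (a - b) + (b - a) * (b - a)

/-- The square of the absolute value of a Gaussian integer. -/
def normSq (x : IntCode) : ℕ := sqDiff x.1 x.2.1 + sqDiff x.2.2.1 x.2.2.2

end IntCode

theorem gaussInt_neg (x : IntCode) : gaussInt x.neg = -gaussInt x := by
  apply Complex.ext <;> simp [gaussInt_re, gaussInt_im, IntCode.neg]

theorem gaussInt_conj (x : IntCode) : gaussInt x.conj = starRingEnd ℂ (gaussInt x) := by
  apply Complex.ext <;> simp [gaussInt_re, gaussInt_im, IntCode.conj]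

theorem gaussInt_mul (x y : IntCode) : gaussInt (x.mul y) = gaussInt x * gaussInt y := by
  apply Complex.ext <;> simp [gaussInt_re, gaussInt_im, IntCode.mul] <;> ring

namespace IntCode

theorem cast_sqDiff (a b : ℕ) : (sqDiff a b : ℝ) = ((a : ℝ) - b) ^ 2 := by
  unfold sqDiff
  rcases le_total a b with h | h <;> rw [Nat.sub_eq_zero_of_le h] <;> push_cast [Nat.cast_sub h] <;>
    ring

theorem cast_normSq (x : IntCode) : (normSq x : ℝ) = ‖gaussInt x‖ ^ 2 := by
  rw [normSq, Nat.cast_add, cast_sqDiff, cast_sqDiff, Complex.sq_norm, Complex.normSq_apply,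
    gaussInt_re, gaussInt_im]
  ring

end IntCode

/-- The coordinates of the `k`-th finitely supported vector; every list of Gaussian integers
occurs. -/
def vectorList (k : ℕ) : List IntCode :=
  (Encodable.decode k).getD []

/-- The `c`-th coordinate of the `k`-th finitely supported vector. -/
def vectorEntry (k c : ℕ) : IntCode := (vectorList k).getD c 0

/-- The `m`-th Gaussian integer. -/
def gridCode (m : ℕ) : IntCode := (Encodable.decode m).getD 0

/-- The position of the `(r, c)`-entry of a matrix or, if `s` is true, of its adjoint, in a sequence
that lists the entries of the matrix by columns. -/
def entryIndex (s : Bool) (r c : ℕ) : ℕ := bif s then Nat.pair r c else Nat.pair c r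

/-- The `r`-th coordinate of `2 ^ (n + 2) (A - z) v`, where `v` is the `k`-th vector, `z` is the
`m`-th grid point of mesh `2 ^ (-n - 2)`, and `A` is the matrix with the bits `w`. If `s` is true,
`A` and `z` are replaced by their adjoint and conjugate. -/
def windowResidual (s : Bool) (n m k : ℕ) (w : List Bool) (r : ℕ) : IntCode :=
  2 ^ (n + 2) • ∑ c ∈ Finset.range (vectorList k).length,
      (bif w.getD (entryIndex s r c) false then vectorEntry k c else 0) +
    ((bif s then (gridCode m).conj else gridCode m).mul (vectorEntry k r)).neg

/-- The inequality `‖(A - z) v‖ < 2 ^ (-n) ‖v‖` as it appears in the window `w`, for `A`,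
`z` and `v` as in `windowResidual`. -/
def WindowTest (s : Bool) (n m k : ℕ) (w : List Bool) : Prop :=
  ∑ r ∈ Finset.range w.length, (windowResidual s n m k w r).normSq <
    16 * ∑ r ∈ Finset.range w.length, (vectorEntry k r).normSq

instance (s : Bool) (n m k : ℕ) (w : List Bool) : Decidable (WindowTest s n m k w) :=
  inferInstanceAs (Decidable (_ < _))

/-- The `m`-th grid point passes the test with one of the first `b` vectors, for the matrix or for
its adjoint, as listed in `S`. -/
def WindowAccepts (S : List Bool) (n b : ℕ) (w : List Bool) (m : ℕ) : Prop :=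
  ∃ k ∈ List.range b, ∃ s ∈ S, WindowTest s n m k w

instance (S : List Bool) (n b : ℕ) (w : List Bool) (m : ℕ) : Decidable (WindowAccepts S n b w m) :=
  inferInstanceAs (Decidable (∃ k ∈ List.range b, ∃ s ∈ S, WindowTest s n m k w))

/-- The code of the `m`-th grid point of mesh `2 ^ (-n - 2)`. -/
def gridPointCode (n m : ℕ) : GaussCode :=
  (((gridCode m).1, (gridCode m).2.1, 2 ^ (n + 2) - 1),
    ((gridCode m).2.2.1, (gridCode m).2.2.2, 2 ^ (n + 2) - 1))

/-- Those of the first `b` grid points that pass the test. -/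
def acceptedList (S : List Bool) (n b : ℕ) (w : List Bool) : List GaussCode :=
  ((List.range b).filter (WindowAccepts S n b w ·)).map (gridPointCode n)

/-- A list of points, with the empty list replaced by the list of the point `0`: algorithms must
have non-empty outputs. -/
def orZero (L : List GaussCode) : List GaussCode := if L = [] then [0] else L

theorem orZero_ne_nil (L : List GaussCode) : orZero L ≠ [] := by
  unfold orZero
  split_ifs with h
  · exact List.cons_ne_nil _ _
  · exact h

section Primrec

variable {α : Type} [Primcodable α]

theorem primrec_sum_range {M : Type} [Primcodable M] [AddCommMonoid M]
    (hadd : Primrec₂ ((· + ·) : M → M → M)) {f : α → ℕ → M} {n : α → ℕ}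
    (hf : Primrec₂ f) (hn : Primrec n) : Primrec fun a => ∑ i ∈ Finset.range (n a), f a i := by
  have hstep : Primrec₂ fun (a : α) (p : ℕ × M) => p.2 + f a p.1 :=
    hadd.comp (Primrec.snd.comp Primrec.snd) (hf.comp Primrec.fst (Primrec.fst.comp Primrec.snd))
  refine (Primrec.nat_rec' hn (Primrec.const 0) hstep).of_eq fun a => ?_
  induction n a with
  | zero => rfl
  | succ m ih => rw [Finset.sum_range_succ, ← ih]

theorem primrec₂_prod_add {M N : Type} [Primcodable M] [Primcodable N] [Add M] [Add N]
    (hM : Primrec₂ ((· + ·) : M → M → M)) (hN : Primrec₂ ((· + ·) : N → N → N)) :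
    Primrec₂ ((· + ·) : M × N → M × N → M × N) :=
  (hM.comp (Primrec.fst.comp Primrec.fst) (Primrec.fst.comp Primrec.snd)).pair
    (hN.comp (Primrec.snd.comp Primrec.fst) (Primrec.snd.comp Primrec.snd))

theorem primrec₂_prod_smul {M N : Type} [Primcodable M] [Primcodable N] [SMul ℕ M] [SMul ℕ N]
    (hM : Primrec₂ ((· • ·) : ℕ → M → M)) (hN : Primrec₂ ((· • ·) : ℕ → N → N)) :
    Primrec₂ ((· • ·) : ℕ → M × N → M × N) :=
  (hM.comp Primrec.fst (Primrec.fst.comp Primrec.snd)).pair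
    (hN.comp Primrec.fst (Primrec.snd.comp Primrec.snd))

theorem primrec_two_pow : Primrec fun n : ℕ => 2 ^ n :=
  (Primrec.nat_rec₁ 1 (f := fun _ y => 2 * y)
    (Primrec.nat_double.comp Primrec.snd)).of_eq fun n => by
    induction n with
    | zero => rfl
    | succ n ih => simp only [ih, pow_succ']

namespace IntCode

theorem primrec₂_add : Primrec₂ ((· + ·) : IntCode → IntCode → IntCode) :=
  primrec₂_prod_add Primrec.nat_add
    (primrec₂_prod_add Primrec.nat_add (primrec₂_prod_add Primrec.nat_add Primrec.nat_add))

theorem primrec₂_smul : Primrec₂ ((· • ·) : ℕ → IntCode → IntCode) :=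
  primrec₂_prod_smul Primrec.nat_mul
    (primrec₂_prod_smul Primrec.nat_mul (primrec₂_prod_smul Primrec.nat_mul Primrec.nat_mul))

theorem primrec_coord₁ : Primrec fun x : IntCode => x.1 := Primrec.fst

theorem primrec_coord₂ : Primrec fun x : IntCode => x.2.1 := Primrec.fst.comp Primrec.snd

theorem primrec_coord₃ : Primrec fun x : IntCode => x.2.2.1 :=
  Primrec.fst.comp (Primrec.snd.comp Primrec.snd)

theorem primrec_coord₄ : Primrec fun x : IntCode => x.2.2.2 :=
  Primrec.snd.comp (Primrec.snd.comp Primrec.snd)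

theorem primrec_neg : Primrec neg :=
  primrec_coord₂.pair (primrec_coord₁.pair (primrec_coord₄.pair primrec_coord₃))

theorem primrec_conj : Primrec conj :=
  primrec_coord₁.pair (primrec_coord₂.pair (primrec_coord₄.pair primrec_coord₃))

theorem primrec₂_mul : Primrec₂ mul := by
  let X : Fin 4 → IntCode → ℕ := ![fun x => x.1, fun x => x.2.1, fun x => x.2.2.1, fun x => x.2.2.2]
  have hX : ∀ i, Primrec (X i) := by
    simpa [X, Fin.forall_fin_succ] using
      ⟨primrec_coord₁, primrec_coord₂, primrec_coord₃, primrec_coord₄⟩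
  have hmul (i j : Fin 4) : Primrec fun p : IntCode × IntCode => X i p.1 * X j p.2 :=
    Primrec.nat_mul.comp ((hX i).comp Primrec.fst) ((hX j).comp Primrec.snd)
  have hsum (i j : Fin 4 → Fin 4) : Primrec fun p : IntCode × IntCode =>
      X (i 0) p.1 * X (j 0) p.2 + X (i 1) p.1 * X (j 1) p.2 +
        (X (i 2) p.1 * X (j 2) p.2 + X (i 3) p.1 * X (j 3) p.2) :=
    Primrec.nat_add.comp (Primrec.nat_add.comp (hmul _ _) (hmul _ _))
      (Primrec.nat_add.comp (hmul _ _) (hmul _ _))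
  exact (hsum id ![0, 1, 3, 2]).pair ((hsum id ![1, 0, 2, 3]).pair
    ((hsum id ![2, 3, 0, 1]).pair (hsum id ![3, 2, 1, 0])))

theorem primrec₂_sqDiff : Primrec₂ sqDiff :=
  Primrec.nat_add.comp (Primrec.nat_mul.comp Primrec.nat_sub Primrec.nat_sub)
    (Primrec.nat_mul.comp Primrec.nat_sub.swap Primrec.nat_sub.swap)

theorem primrec_normSq : Primrec normSq :=
  Primrec.nat_add.comp (primrec₂_sqDiff.comp primrec_coord₁ primrec_coord₂)
    (primrec₂_sqDiff.comp primrec_coord₃ primrec_coord₄)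

end IntCode

theorem primrec_vectorList : Primrec vectorList :=
  Primrec.option_getD.comp Primrec.decode (Primrec.const [])

theorem primrec₂_vectorEntry : Primrec₂ vectorEntry :=
  (Primrec.list_getD 0).comp (primrec_vectorList.comp Primrec.fst) Primrec.snd

theorem primrec_gridCode : Primrec gridCode :=
  Primrec.option_getD.comp Primrec.decode (Primrec.const 0)

variable {s : α → Bool} {n m k b r : α → ℕ} {w : α → List Bool}

theorem primrec_entryIndex {c : α → ℕ} (hs : Primrec s) (hr : Primrec r) (hc : Primrec c) :
    Primrec fun a => entryIndex (s a) (r a) (c a) :=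
  Primrec.cond hs (Primrec₂.natPair.comp hr hc) (Primrec₂.natPair.comp hc hr)

theorem primrec_mesh (hn : Primrec n) : Primrec fun a => 2 ^ (n a + 2) :=
  primrec_two_pow.comp (Primrec.succ.comp (Primrec.succ.comp hn))

theorem primrec_windowResidual (hs : Primrec s) (hn : Primrec n) (hm : Primrec m) (hk : Primrec k)
    (hw : Primrec w) (hr : Primrec r) :
    Primrec fun a => windowResidual (s a) (n a) (m a) (k a) (w a) (r a) := by
  have hterm : Primrec₂ fun (a : α) (c : ℕ) =>
      bif (w a).getD (entryIndex (s a) (r a) c) false then vectorEntry (k a) c else 0 :=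
    Primrec.cond ((Primrec.list_getD false).comp (hw.comp Primrec.fst)
        (primrec_entryIndex (hs.comp Primrec.fst) (hr.comp Primrec.fst) Primrec.snd))
      (primrec₂_vectorEntry.comp (hk.comp Primrec.fst) Primrec.snd) (Primrec.const 0)
  have hpoint : Primrec fun a => bif s a then (gridCode (m a)).conj else gridCode (m a) :=
    Primrec.cond hs (IntCode.primrec_conj.comp (primrec_gridCode.comp hm))
      (primrec_gridCode.comp hm)
  exact IntCode.primrec₂_add.comp
    (IntCode.primrec₂_smul.comp (primrec_mesh hn) (primrec_sum_range IntCode.primrec₂_add hterm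
      (Primrec.list_length.comp (primrec_vectorList.comp hk))))
    (IntCode.primrec_neg.comp (IntCode.primrec₂_mul.comp hpoint (primrec₂_vectorEntry.comp hk hr)))

theorem primrecPred_windowTest (hs : Primrec s) (hn : Primrec n) (hm : Primrec m) (hk : Primrec k)
    (hw : Primrec w) : PrimrecPred fun a => WindowTest (s a) (n a) (m a) (k a) (w a) := by
  have hresidual : Primrec₂ fun (a : α) (r : ℕ) =>
      (windowResidual (s a) (n a) (m a) (k a) (w a) r).normSq :=
    IntCode.primrec_normSq.comp (primrec_windowResidual (hs.comp Primrec.fst) (hn.comp Primrec.fst)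
      (hm.comp Primrec.fst) (hk.comp Primrec.fst) (hw.comp Primrec.fst) Primrec.snd)
  have hentry : Primrec₂ fun (a : α) (r : ℕ) => (vectorEntry (k a) r).normSq :=
    IntCode.primrec_normSq.comp (primrec₂_vectorEntry.comp (hk.comp Primrec.fst) Primrec.snd)
  have hlen : Primrec fun a => (w a).length := Primrec.list_length.comp hw
  exact Primrec.nat_lt.comp (primrec_sum_range Primrec.nat_add hresidual hlen)
    (Primrec.nat_mul.comp (Primrec.const 16) (primrec_sum_range Primrec.nat_add hentry hlen))

theorem primrecPred_windowAccepts (S : List Bool) (hn : Primrec n) (hb : Primrec b)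
    (hw : Primrec w) (hm : Primrec m) :
    PrimrecPred fun a => WindowAccepts S (n a) (b a) (w a) (m a) := by
  have htest : PrimrecRel fun (s : Bool) (p : ℕ × α) =>
      WindowTest s (n p.2) (m p.2) p.1 (w p.2) :=
    primrecPred_windowTest Primrec.fst (hn.comp (Primrec.snd.comp Primrec.snd))
      (hm.comp (Primrec.snd.comp Primrec.snd)) (Primrec.fst.comp Primrec.snd)
      (hw.comp (Primrec.snd.comp Primrec.snd))
  have hsides : PrimrecRel fun (k : ℕ) (a : α) => ∃ s ∈ S, WindowTest s (n a) (m a) k (w a) :=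
    htest.exists_mem_list.comp (Primrec.const S) Primrec.id
  exact hsides.exists_mem_list.comp (Primrec.list_range.comp hb) Primrec.id

theorem primrec_gridPointCode (hn : Primrec n) (hm : Primrec m) :
    Primrec fun a => gridPointCode (n a) (m a) := by
  have hgrid := primrec_gridCode.comp hm
  have hden : Primrec fun a => 2 ^ (n a + 2) - 1 := Primrec.pred.comp (primrec_mesh hn)
  exact Primrec.pair
    ((IntCode.primrec_coord₁.comp hgrid).pair ((IntCode.primrec_coord₂.comp hgrid).pair hden))
    ((IntCode.primrec_coord₃.comp hgrid).pair ((IntCode.primrec_coord₄.comp hgrid).pair hden))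

theorem primrec_acceptedList (S : List Bool) (hn : Primrec n) (hb : Primrec b) (hw : Primrec w) :
    Primrec fun a => acceptedList S (n a) (b a) (w a) := by
  have haccepts : PrimrecRel fun (m : ℕ) (a : α) => WindowAccepts S (n a) (b a) (w a) m :=
    primrecPred_windowAccepts S (hn.comp Primrec.snd) (hb.comp Primrec.snd) (hw.comp Primrec.snd)
      Primrec.fst
  exact Primrec.list_map (haccepts.listFilter.comp (Primrec.list_range.comp hb) Primrec.id)
    (primrec_gridPointCode (hn.comp Primrec.fst) Primrec.snd)

theorem primrec_orZero : Primrec orZero :=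
  Primrec.ite (Primrec.eq.comp Primrec.id (Primrec.const [])) (Primrec.const [0]) Primrec.id

end Primrec

/-! ## Approximate eigenvectors -/

section

variable {E : Type*} [NormedAddCommGroup E] [NormedSpace ℂ E]

theorem norm_sub_smul_le (x y : E) (z w : ℂ) :
    ‖y - w • x‖ ≤ ‖y - z • x‖ + dist z w * ‖x‖ := by
  rw [dist_eq_norm, ← norm_smul, sub_smul]
  exact norm_sub_le_norm_sub_add_norm_sub _ _ _

/-- There is an `ε`-approximate eigenvector of `T` at `z`. -/
def HasApproxEigenvector (T : E →L[ℂ] E) (z : ℂ) (ε : ℝ) : Prop :=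
  ∃ x, ‖T x - z • x‖ < ε * ‖x‖

theorem hasApproxEigenvector_of_dist_lt {T : E →L[ℂ] E} {w z : ℂ} {ε : ℝ}
    (hw : w ∈ approximatePointSpectrum T) (h : dist z w < ε) : HasApproxEigenvector T z ε := by
  contrapose! hw
  refine (notMem_approximatePointSpectrum_iff T w).2 ⟨ε - dist z w, by linarith, fun x => ?_⟩
  have hx : ε * ‖x‖ ≤ ‖T x - z • x‖ := not_lt.1 fun hx => hw ⟨x, hx⟩
  rw [sub_mul, dist_comm]
  linarith [norm_sub_smul_le x (T x) w z]

theorem HasApproxEigenvector.mono {T : E →L[ℂ] E} {z : ℂ} {ε ε' : ℝ}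
    (h : HasApproxEigenvector T z ε) (hε : ε ≤ ε') : HasApproxEigenvector T z ε' :=
  h.imp fun _ hx => hx.trans_le (by gcongr)

theorem HasApproxEigenvector.norm_lt {T : E →L[ℂ] E} {z : ℂ} {ε : ℝ}
    (h : HasApproxEigenvector T z ε) : ‖z‖ < ‖T‖ + ε := by
  obtain ⟨x, hx⟩ := h
  refine lt_of_mul_lt_mul_right ?_ (norm_nonneg x)
  have htriangle := norm_sub_norm_le (z • x) (T x)
  rw [norm_sub_rev, norm_smul] at htriangle
  linarith [T.le_opNorm x]

theorem exists_dist_lt_of_hasApproxEigenvector (T : E →L[ℂ] E) {δ : ℝ} (hδ : 0 < δ) :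
    ∃ ε > 0, ∀ z, HasApproxEigenvector T z ε → ∃ w ∈ approximatePointSpectrum T, dist z w < δ := by
  by_contra! hc
  choose z hz hfar using fun n : ℕ => hc (1 / ((n : ℝ) + 1)) (by positivity)
  have hbdd : ∀ n, z n ∈ Metric.closedBall (0 : ℂ) (‖T‖ + 1) := fun n =>
    mem_closedBall_zero_iff.2 ((hz n).mono
      ((div_le_one (by positivity)).2 (by simp))).norm_lt.le
  obtain ⟨w, -, φ, hφ, hlim⟩ := (isCompact_closedBall (0 : ℂ) (‖T‖ + 1)).tendsto_subseq hbdd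
  have hdist := tendsto_iff_dist_tendsto_zero.1 hlim
  have hw : w ∈ approximatePointSpectrum T := by
    by_contra hw
    obtain ⟨c, hc, hlow⟩ := (notMem_approximatePointSpectrum_iff T w).1 hw
    have hsum := ((tendsto_one_div_add_atTop_nhds_zero_nat (𝕜 := ℝ)).comp hφ.tendsto_atTop).add
      hdist
    rw [add_zero] at hsum
    obtain ⟨n, hn⟩ := (hsum.eventually (gt_mem_nhds hc)).exists
    obtain ⟨x, hx⟩ := hz (φ n)
    have hmul := mul_le_mul_of_nonneg_right hn.le (norm_nonneg x)
    simp only [Function.comp_apply, add_mul] at hmul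
    linarith [hlow x, norm_sub_smul_le x (T x) (z (φ n)) w]
  obtain ⟨n, hn⟩ := (hdist.eventually (gt_mem_nhds hδ)).exists
  exact absurd hn (not_lt.2 (hfar (φ n) w hw))

end

section

variable {H : Type*} [NormedAddCommGroup H] [InnerProductSpace ℂ H] [CompleteSpace H]

theorem isUnit_of_forall_le_norm {S : H →L[ℂ] H} {c : ℝ} (hc : 0 < c)
    (hlow : ∀ x, c * ‖x‖ ≤ ‖S x‖) (hadj : Function.Injective (star S : H →L[ℂ] H)) : IsUnit S := by
  rw [ContinuousLinearMap.isUnit_iff_bijective,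
    ContinuousLinearMap.bijective_iff_dense_range_and_antilipschitz]
  refine ⟨?_, ⟨c⁻¹, by positivity⟩, AddMonoidHomClass.antilipschitz_of_bound S fun x => ?_⟩
  · rw [Submodule.topologicalClosure_eq_top_iff, ContinuousLinearMap.orthogonal_range]
    exact LinearMap.ker_eq_bot.2 hadj
  · exact (le_inv_mul_iff₀ hc).2 (hlow x)

theorem mem_spectrum_iff_approximatePointSpectrum (T : H →L[ℂ] H) (z : ℂ) :
    z ∈ spectrum ℂ T ↔ z ∈ approximatePointSpectrum T ∨
      star z ∈ approximatePointSpectrum (star T) := by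
  constructor
  · contrapose!
    rintro ⟨hz, hz'⟩
    obtain ⟨c, hc, hlow⟩ := (notMem_approximatePointSpectrum_iff _ _).1 hz
    obtain ⟨d, hd, hlow'⟩ := (notMem_approximatePointSpectrum_iff _ _).1 hz'
    rw [spectrum.notMem_iff, ← IsUnit.neg_iff, neg_sub, Algebra.algebraMap_eq_smul_one]
    refine isUnit_of_forall_le_norm hc (fun x => by simpa using hlow x)
      ((injective_iff_map_eq_zero _).2 fun x hx => ?_)
    have hx' := hlow' x
    have : star T x - star z • x = 0 := by simpa using hx
    rw [this, norm_zero] at hx'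
    exact norm_le_zero_iff.1 (nonpos_of_mul_nonpos_right hx' hd)
  · rintro (h | h)
    · exact approximatePointSpectrum_subset_spectrum T h
    · have := approximatePointSpectrum_subset_spectrum _ h
      rwa [← Set.mem_star, ← spectrum.map_star, star_star] at this

end

section

/-- The element `star a` if `s` is true, and `a` otherwise. -/
def starIf {R : Type*} [Star R] (s : Bool) (a : R) : R := bif s then star a else a

theorem starIf_starIf {R : Type*} [InvolutiveStar R] (s : Bool) (a : R) :
    starIf s (starIf s a) = a := by
  cases s <;> simp [starIf]

variable {R : Type*} [SeminormedAddCommGroup R] [StarAddMonoid R] [NormedStarGroup R]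

theorem norm_starIf (s : Bool) (a : R) : ‖starIf s a‖ = ‖a‖ := by
  cases s <;> simp [starIf]

theorem dist_starIf (s : Bool) (a b : R) : dist (starIf s a) (starIf s b) = dist a b := by
  cases s
  · rfl
  · simp only [starIf, cond_true, dist_eq_norm, ← star_sub, norm_star]

end

section

variable {H : Type*} [NormedAddCommGroup H] [InnerProductSpace ℂ H] [CompleteSpace H]

/-- The approximate point spectrum of `T`, if `S` is `[false]`, and the spectrum of `T`, if `S` is
`[false, true]`. -/
def sideSpectrum (S : List Bool) (T : H →L[ℂ] H) : Set ℂ :=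
  {z | ∃ s ∈ S, starIf s z ∈ approximatePointSpectrum (starIf s T)}

theorem sideSpectrum_singleton_false (T : H →L[ℂ] H) :
    sideSpectrum [false] T = approximatePointSpectrum T := by
  simp [sideSpectrum, starIf]

theorem sideSpectrum_pair (T : H →L[ℂ] H) : sideSpectrum [false, true] T = spectrum ℂ T := by
  ext z
  rw [mem_spectrum_iff_approximatePointSpectrum]
  simp [sideSpectrum, starIf]

end

/-! ## Finitely supported vectors -/

/-- The `k`-th finitely supported vector. -/
noncomputable def finiteVector (k : ℕ) : EllTwo :=
  ∑ c ∈ Finset.range (vectorList k).length, lp.single 2 c (gaussInt (vectorEntry k c))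

theorem finiteVector_apply (k r : ℕ) : finiteVector k r = gaussInt (vectorEntry k r) := by
  rw [finiteVector, lp.coeFn_sum, Finset.sum_apply]
  simp only [lp.single_apply, Pi.single_apply]
  rw [Finset.sum_ite_eq, ite_eq_left_iff, Finset.mem_range, not_lt]
  intro h
  rw [vectorEntry, List.getD_eq_default _ _ h, map_zero]

theorem finiteVector_apply_eq_zero {k r : ℕ} (h : (vectorList k).length ≤ r) :
    finiteVector k r = 0 := by
  rw [finiteVector_apply, vectorEntry, List.getD_eq_default _ _ h, map_zero]

/-- A Gaussian integer close to `N w`. -/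
noncomputable def roundCode (N : ℕ) (w : ℂ) : IntCode :=
  (⌊N * w.re⌋.toNat, (-⌊N * w.re⌋).toNat, ⌊N * w.im⌋.toNat, (-⌊N * w.im⌋).toNat)

theorem abs_toNat_floor_sub_div_sub_le {N : ℕ} (hN : 0 < N) (t : ℝ) :
    |((⌊N * t⌋.toNat : ℝ) - (-⌊N * t⌋).toNat) / N - t| ≤ 1 / N := by
  have hN' : (0 : ℝ) < N := Nat.cast_pos.2 hN
  have hfloor : (⌊N * t⌋.toNat : ℝ) - (-⌊N * t⌋).toNat = ⌊N * t⌋ := by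
    exact_mod_cast Int.toNat_sub_toNat_neg ⌊N * t⌋
  rw [hfloor, div_sub' hN'.ne', abs_div, abs_of_pos hN', div_le_div_iff_of_pos_right hN', abs_le]
  constructor <;> linarith [Int.floor_le (N * t), Int.lt_floor_add_one (N * t)]

theorem dist_roundCode_le {N : ℕ} (hN : 0 < N) (w : ℂ) :
    dist (gaussInt (roundCode N w) / N) w ≤ 2 / N := by
  rw [dist_eq_norm, show (2 : ℝ) / N = 1 / N + 1 / N by ring]
  refine (Complex.norm_le_abs_re_add_abs_im _).trans (add_le_add ?_ ?_)
  · rw [Complex.sub_re, Complex.div_natCast_re]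
    exact abs_toNat_floor_sub_div_sub_le hN w.re
  · rw [Complex.sub_im, Complex.div_natCast_im]
    exact abs_toNat_floor_sub_div_sub_le hN w.im

theorem finiteVector_encode_map (s : ℕ) (f : ℕ → IntCode) :
    finiteVector (Encodable.encode ((List.range s).map f)) =
      ∑ c ∈ Finset.range s, lp.single 2 c (gaussInt (f c)) := by
  have hlist : vectorList (Encodable.encode ((List.range s).map f)) = (List.range s).map f := by
    rw [vectorList, Encodable.encodek, Option.getD_some]
  rw [finiteVector, hlist, List.length_map, List.length_range]
  refine Finset.sum_congr rfl fun c hc => ?_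
  rw [vectorEntry, hlist, List.getD_eq_getElem _ _ (by simpa using hc)]
  simp

theorem tendsto_sum_single_roundCode (x : EllTwo) (s : ℕ) :
    Tendsto (fun N : ℕ => ∑ c ∈ Finset.range s,
        (lp.single 2 c (gaussInt (roundCode N (x c)) / N) : EllTwo)) atTop
      (𝓝 (∑ c ∈ Finset.range s, lp.single 2 c (x c))) := by
  refine tendsto_finsetSum _ fun c _ =>
    ((lp.isometry_single (E := fun _ : ℕ => ℂ) (p := 2) c).continuous.tendsto _).comp ?_
  rw [tendsto_iff_dist_tendsto_zero]
  refine squeeze_zero' (.of_forall fun _ => dist_nonneg) ?_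
    (tendsto_const_nhds.div_atTop tendsto_natCast_atTop_atTop : Tendsto (2 / · : ℕ → ℝ) _ _)
  filter_upwards [eventually_gt_atTop 0] with N hN using dist_roundCode_le hN (x c)

theorem HasApproxEigenvector.exists_finiteVector {T : EllTwo →L[ℂ] EllTwo} {z : ℂ} {ε : ℝ}
    (h : HasApproxEigenvector T z ε) :
    ∃ k, ‖T (finiteVector k) - z • finiteVector k‖ < ε * ‖finiteVector k‖ := by
  obtain ⟨x, hx⟩ := h
  have hopen : IsOpen {y : EllTwo | ‖T y - z • y‖ < ε * ‖y‖} :=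
    isOpen_lt (by fun_prop) (by fun_prop)
  have htrunc : Tendsto (fun s : ℕ => ∑ c ∈ Finset.range s, lp.single 2 c (x c)) atTop (𝓝 x) :=
    (lp.hasSum_single (by simp) x).tendsto_sum_nat
  obtain ⟨s, hs⟩ := (htrunc.eventually (hopen.mem_nhds hx)).exists
  obtain ⟨N, hN, hN0⟩ := (((tendsto_sum_single_roundCode x s).eventually
    (hopen.mem_nhds hs)).and (eventually_ne_atTop 0)).exists
  have hN0' : (N : ℂ) ≠ 0 := Nat.cast_ne_zero.2 hN0
  refine ⟨Encodable.encode ((List.range s).map fun c => roundCode N (x c)), ?_⟩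
  have hscale : ∑ c ∈ Finset.range s, lp.single 2 c (gaussInt (roundCode N (x c))) =
      (N : ℂ) • ∑ c ∈ Finset.range s,
        (lp.single 2 c (gaussInt (roundCode N (x c)) / N) : EllTwo) := by
    simp only [Finset.smul_sum, ← lp.single_smul, smul_eq_mul, mul_div_cancel₀ _ hN0']
  rw [finiteVector_encode_map, hscale, map_smul, smul_comm z, ← smul_sub, norm_smul, norm_smul,
    mul_left_comm]
  exact mul_lt_mul_of_pos_left hN (norm_pos_iff.2 hN0')

theorem norm_sq_eq_sum_of_eq_zero {x : EllTwo} {R : ℕ} (h : ∀ r, R ≤ r → x r = 0) :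
    ‖x‖ ^ 2 = ∑ r ∈ Finset.range R, ‖x r‖ ^ 2 := by
  have hnorm := lp.norm_rpow_eq_tsum (p := 2) (by simp) x
  simp only [ENNReal.toReal_ofNat, Real.rpow_ofNat] at hnorm
  rw [hnorm, tsum_eq_sum (s := Finset.range R) fun r hr => by simp [h r (by simpa using hr)]]

/-! ## Correctness of the window test -/

/-- The matrix of `T` consists of zeros and ones, and `b` lists its entries by columns. -/
def HasBinaryMatrix (T : EllTwo →L[ℂ] EllTwo) (b : ℕ → Bool) : Prop :=
  ∀ r c, T (lp.single 2 c 1) r = if b (Nat.pair c r) then 1 else 0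

/-- The columns that the `k`-th vector meets have all their non-zero entries in the first `N` rows
and at the first `N` positions of the sequence of bits. -/
def WindowCovers (b : ℕ → Bool) (s : Bool) (k N : ℕ) : Prop :=
  ∀ c ∈ Finset.range (vectorList k).length, ∀ r ∈ {r | b (entryIndex s r c)},
    r < N ∧ entryIndex s r c < N

theorem window_getD (b : ℕ → Bool) (N i : ℕ) :
    (window b N).getD i false = (decide (i < N) && b i) := by
  by_cases h : i < N
  · rw [List.getD_eq_getElem _ _ (by simpa [window] using h)]
    simp [window, h]
  · rw [List.getD_eq_default _ _ (by simpa [window] using h)]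
    simp [h]

/-- The `m`-th grid point of mesh `2 ^ (-n - 2)`. -/
noncomputable def gridPoint (n m : ℕ) : ℂ := gaussInt (gridCode m) / (2 ^ (n + 2) : ℕ)

theorem gaussInt_conj_gridCode (s : Bool) (n m : ℕ) :
    gaussInt (bif s then (gridCode m).conj else gridCode m) =
      (2 ^ (n + 2) : ℕ) * starIf s (gridPoint n m) := by
  have hmesh : ((2 ^ (n + 2) : ℕ) : ℂ) ≠ 0 := Nat.cast_ne_zero.2 (by positivity)
  rw [gridPoint]
  cases s <;> simp only [starIf, cond_true, cond_false, gaussInt_conj, starRingEnd_apply, star_div₀,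
    star_natCast, mul_div_cancel₀ _ hmesh]

namespace HasBinaryMatrix

variable {T : EllTwo →L[ℂ] EllTwo} {b : ℕ → Bool}

theorem starIf_single_apply (h : HasBinaryMatrix T b) (s : Bool) (r c : ℕ) :
    starIf s T (lp.single 2 c 1) r = if b (entryIndex s r c) then 1 else 0 := by
  cases s
  · exact h r c
  · have hinner : star (T (lp.single 2 r 1) c) = star T (lp.single 2 c 1) r := by
      simpa [ContinuousLinearMap.star_eq_adjoint, lp.inner_single_left, lp.inner_single_right] using
        (ContinuousLinearMap.adjoint_inner_right T (lp.single 2 r 1) (lp.single 2 c 1)).symm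
    rw [starIf, cond_true, ← hinner, h c r, entryIndex, cond_true]
    split_ifs <;> simp

theorem starIf_finiteVector_apply (h : HasBinaryMatrix T b) (s : Bool) (k r : ℕ) :
    starIf s T (finiteVector k) r = ∑ c ∈ Finset.range (vectorList k).length,
      if b (entryIndex s r c) then gaussInt (vectorEntry k c) else 0 := by
  rw [finiteVector, map_sum, lp.coeFn_sum, Finset.sum_apply]
  refine Finset.sum_congr rfl fun c _ => ?_
  rw [← mul_one (gaussInt _), ← smul_eq_mul, lp.single_smul, map_smul, lp.coeFn_smul,
    Pi.smul_apply, h.starIf_single_apply]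
  simp

theorem finite_column (h : HasBinaryMatrix T b) (s : Bool) (c : ℕ) :
    {r | b (entryIndex s r c)}.Finite := by
  have hsummable : Summable fun r => ‖starIf s T (lp.single 2 c 1) r‖ ^ (2 : ℝ) := by
    simpa using (lp.memℓp (starIf s T (lp.single 2 c 1))).summable (by simp)
  refine (hsummable.tendsto_cofinite_zero.eventually (gt_mem_nhds one_pos)).subset fun r hr => ?_
  simp [h.starIf_single_apply, show b (entryIndex s r c) = true from hr]

theorem eventually_windowCovers (h : HasBinaryMatrix T b) (s : Bool) (k : ℕ) :
    ∀ᶠ N in atTop, WindowCovers b s k N := by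
  unfold WindowCovers
  rw [Finset.eventually_all]
  intro c _
  rw [Filter.eventually_all_finite (h.finite_column s c)]
  exact fun r _ => (eventually_gt_atTop r).and (eventually_gt_atTop _)

variable {s : Bool} {k N : ℕ}

theorem gaussInt_windowResidual (h : HasBinaryMatrix T b)
    (hN : WindowCovers b s k N) (n m r : ℕ) :
    gaussInt (windowResidual s n m k (window b N) r) = (2 ^ (n + 2) : ℕ) *
      (starIf s T (finiteVector k) - starIf s (gridPoint n m) • finiteVector k) r := by
  have hsum : gaussInt (∑ c ∈ Finset.range (vectorList k).length,
      bif (window b N).getD (entryIndex s r c) false then vectorEntry k c else 0) =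
        starIf s T (finiteVector k) r := by
    rw [h.starIf_finiteVector_apply, map_sum]
    refine Finset.sum_congr rfl fun c hc => ?_
    rw [window_getD]
    by_cases hb : b (entryIndex s r c)
    · simp [hb, (hN c hc r hb).2]
    · simp [hb]
  rw [windowResidual, map_add, map_nsmul, hsum, gaussInt_neg, gaussInt_mul, gaussInt_conj_gridCode,
    lp.coeFn_sub, Pi.sub_apply, lp.coeFn_smul, Pi.smul_apply, finiteVector_apply, nsmul_eq_mul,
    smul_eq_mul]
  ring

theorem starIf_finiteVector_apply_eq_zero (h : HasBinaryMatrix T b)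
    (hN : WindowCovers b s k N) {r : ℕ} (hr : N ≤ r) :
    starIf s T (finiteVector k) r = 0 := by
  rw [h.starIf_finiteVector_apply]
  exact Finset.sum_eq_zero fun c hc => if_neg fun hb => (hN c hc r hb).1.not_ge hr

theorem eventually_windowTest_iff (h : HasBinaryMatrix T b) (s : Bool) (n m k : ℕ) :
    ∀ᶠ N in atTop, WindowTest s n m k (window b N) ↔
      ‖starIf s T (finiteVector k) - starIf s (gridPoint n m) • finiteVector k‖ <
        (1 / 2) ^ n * ‖finiteVector k‖ := by
  filter_upwards [h.eventually_windowCovers s k, eventually_ge_atTop (vectorList k).length]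
    with N hN hlen
  have hv : ∀ r, N ≤ r → finiteVector k r = 0 := fun r hr =>
    finiteVector_apply_eq_zero (hlen.trans hr)
  have hresidual : ∀ r, N ≤ r →
      (starIf s T (finiteVector k) - starIf s (gridPoint n m) • finiteVector k) r = 0 :=
    fun r hr => by
      rw [lp.coeFn_sub, Pi.sub_apply, lp.coeFn_smul, Pi.smul_apply, hv r hr, smul_zero, sub_zero,
        h.starIf_finiteVector_apply_eq_zero hN hr]
  have hleft : ((∑ r ∈ Finset.range N, (windowResidual s n m k (window b N) r).normSq : ℕ) : ℝ) =
      (2 ^ (n + 2) *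
        ‖starIf s T (finiteVector k) - starIf s (gridPoint n m) • finiteVector k‖) ^ 2 := by
    simp [IntCode.cast_normSq, h.gaussInt_windowResidual hN, mul_pow, ← Finset.mul_sum,
      norm_sq_eq_sum_of_eq_zero hresidual]
  have hright : ((16 * ∑ r ∈ Finset.range N, (vectorEntry k r).normSq : ℕ) : ℝ) =
      (4 * ‖finiteVector k‖) ^ 2 := by
    rw [mul_pow, norm_sq_eq_sum_of_eq_zero hv]
    norm_num [IntCode.cast_normSq, finiteVector_apply]
  have hwidth : (window b N).length = N := by simp [window]
  rw [WindowTest, hwidth, ← Nat.cast_lt (α := ℝ), hleft, hright,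
    pow_lt_pow_iff_left₀ (by positivity) (by positivity) two_ne_zero, one_div, inv_pow,
    inv_mul_eq_div, lt_div_iff₀ (by positivity), pow_add]
  constructor <;> intro hlt <;> linarith

end HasBinaryMatrix

/-! ## The tower -/

open Classical in
/-- A finite non-empty set as a point of the Hausdorff space. Other sets are sent to `{0}`. -/
noncomputable def compactOfFinite (s : Set ℂ) : HausdorffSpace :=
  if h : s.Finite ∧ s.Nonempty then ⟨⟨s, h.1.isCompact⟩, h.2⟩ else {0}

theorem coe_compactOfFinite {s : Set ℂ} (h : s.Finite) (h' : s.Nonempty) :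
    (compactOfFinite s : Set ℂ) = s := by
  rw [compactOfFinite, dif_pos ⟨h, h'⟩]
  rfl

theorem coe_compactOfFinite_codes (L : List GaussCode) :
    (compactOfFinite {z | ∃ c ∈ L, gaussOfCode c = z} : Set ℂ) =
      {z | ∃ c ∈ orZero L, gaussOfCode c = z} := by
  rcases eq_or_ne L [] with rfl | hL
  · have hzero : gaussOfCode 0 = 0 := by simp [gaussOfCode, ratOfCode]
    simp [compactOfFinite, orZero, hzero]
  · rw [orZero, if_neg hL]
    obtain ⟨c, hc⟩ := List.exists_mem_of_ne_nil L hL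
    exact coe_compactOfFinite ((List.finite_toSet L).image gaussOfCode) ⟨_, c, hc, rfl⟩

theorem gaussOfCode_gridPointCode (n m : ℕ) : gaussOfCode (gridPointCode n m) = gridPoint n m := by
  have hden : ((2 ^ (n + 2) - 1 : ℕ) : ℝ) + 1 = (2 ^ (n + 2) : ℕ) := by
    exact_mod_cast Nat.sub_add_cancel Nat.one_le_two_pow
  apply Complex.ext
  · rw [gaussOfCode_re, gridPoint, Complex.div_natCast_re, ← hden]
    simp [gridPointCode, ratOfCode, gaussInt_re]
  · rw [gaussOfCode_im, gridPoint, Complex.div_natCast_im, ← hden]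
    simp [gridPointCode, ratOfCode, gaussInt_im]

theorem finite_gaussInt_norm_le (C : ℝ) : {z | z ∈ Set.range gaussInt ∧ ‖z‖ ≤ C}.Finite := by
  obtain ⟨M, hM⟩ := exists_nat_ge C
  refine ((Set.toFinite (Set.Icc (-M : ℤ) M ×ˢ Set.Icc (-M : ℤ) M)).image
    fun p : ℤ × ℤ => (⟨p.1, p.2⟩ : ℂ)).subset ?_
  rintro _ ⟨⟨x, rfl⟩, hx⟩
  have hre := (Complex.abs_re_le_norm _).trans (hx.trans hM)
  have him := (Complex.abs_im_le_norm _).trans (hx.trans hM)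
  rw [gaussInt_re, abs_le] at hre
  rw [gaussInt_im, abs_le] at him
  refine ⟨((x.1 : ℤ) - x.2.1, (x.2.2.1 : ℤ) - x.2.2.2), ?_, ?_⟩
  · simp only [Set.mem_prod, Set.mem_Icc]
    exact_mod_cast And.intro hre him
  · apply Complex.ext <;> simp [gaussInt_re, gaussInt_im]

theorem finite_gridPoint_norm_le (n : ℕ) (C : ℝ) :
    {z | z ∈ Set.range (gridPoint n) ∧ ‖z‖ ≤ C}.Finite := by
  refine ((finite_gaussInt_norm_le (C * (2 ^ (n + 2) : ℕ))).image
    fun x : ℂ => x / (2 ^ (n + 2) : ℕ)).subset ?_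
  rintro _ ⟨⟨m, rfl⟩, hm⟩
  rw [gridPoint, norm_div, Complex.norm_natCast, div_le_iff₀ (by positivity)] at hm
  exact ⟨_, ⟨⟨_, rfl⟩, hm⟩, rfl⟩

theorem exists_dist_gridPoint_lt (n : ℕ) (w : ℂ) : ∃ m, dist (gridPoint n m) w < (1 / 2) ^ n := by
  refine ⟨Encodable.encode (roundCode (2 ^ (n + 2)) w), ?_⟩
  rw [gridPoint, gridCode, Encodable.encodek, Option.getD_some]
  refine (dist_roundCode_le (by positivity) w).trans_lt ?_
  rw [one_div, inv_pow, div_lt_iff₀ (by positivity), inv_mul_eq_div, lt_div_iff₀ (by positivity)]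
  push_cast
  rw [pow_add]
  linarith [pow_pos (two_pos (α := ℝ)) n]

section

variable (S : List Bool) (T : EllTwo →L[ℂ] EllTwo) (n : ℕ)

/-- The grid points of mesh `2 ^ (-n - 2)` with a `2 ^ (-n)`-approximate eigenvector, of `T` or of
its adjoint, as listed in `S`. -/
def acceptedPoints : Set ℂ :=
  {z | z ∈ Set.range (gridPoint n) ∧
    ∃ s ∈ S, HasApproxEigenvector (starIf s T) (starIf s z) ((1 / 2) ^ n)}

/-- Those of the first `b` grid points for which one of the first `b` finitely supported vectors is
an approximate eigenvector. -/
def acceptedUpTo (b : ℕ) : Set ℂ :=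
  {z | ∃ m < b, (∃ k < b, ∃ s ∈ S,
    ‖starIf s T (finiteVector k) - starIf s (gridPoint n m) • finiteVector k‖ <
      (1 / 2) ^ n * ‖finiteVector k‖) ∧ gridPoint n m = z}

theorem finite_acceptedPoints : (acceptedPoints S T n).Finite := by
  refine (finite_gridPoint_norm_le n (‖T‖ + (1 / 2) ^ n)).subset ?_
  rintro z ⟨hz, s, -, h⟩
  have hnorm := h.norm_lt
  rw [norm_starIf, norm_starIf s T] at hnorm
  exact ⟨hz, hnorm.le⟩

theorem eventually_acceptedUpTo_eq :
    ∀ᶠ b in atTop, acceptedUpTo S T n b = acceptedPoints S T n := by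
  have hsup : ∀ᶠ b in atTop, ∀ z ∈ acceptedPoints S T n, z ∈ acceptedUpTo S T n b := by
    rw [Filter.eventually_all_finite (finite_acceptedPoints S T n)]
    rintro _ ⟨⟨m, rfl⟩, s, hs, h⟩
    obtain ⟨k, hk⟩ := h.exists_finiteVector
    filter_upwards [eventually_gt_atTop m, eventually_gt_atTop k] with b hm hkb
    exact ⟨m, hm, ⟨k, hkb, s, hs, hk⟩, rfl⟩
  filter_upwards [hsup] with b hb
  refine Set.Subset.antisymm ?_ hb
  rintro _ ⟨m, -, ⟨k, -, s, hs, h⟩, rfl⟩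
  exact ⟨⟨m, rfl⟩, s, hs, _, h⟩

theorem setOf_gaussOfCode_acceptedList (b : ℕ) (w : List Bool) :
    {z | ∃ c ∈ acceptedList S n b w, gaussOfCode c = z} =
      {z | ∃ m < b, WindowAccepts S n b w m ∧ gridPoint n m = z} := by
  ext z
  simp only [acceptedList, List.mem_map, List.mem_filter, List.mem_range, decide_eq_true_eq]
  constructor
  · rintro ⟨_, ⟨m, ⟨hm, h⟩, rfl⟩, rfl⟩
    exact ⟨m, hm, h, (gaussOfCode_gridPointCode n m).symm⟩
  · rintro ⟨m, hm, h, rfl⟩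
    exact ⟨_, ⟨m, ⟨hm, h⟩, rfl⟩, gaussOfCode_gridPointCode n m⟩

theorem HasBinaryMatrix.eventually_acceptedList_eq {T : EllTwo →L[ℂ] EllTwo} {β : ℕ → Bool}
    (h : HasBinaryMatrix T β) (b : ℕ) :
    ∀ᶠ N in atTop, {z | ∃ c ∈ acceptedList S n b (window β N), gaussOfCode c = z} =
      acceptedUpTo S T n b := by
  have htest : ∀ᶠ N in atTop, ∀ m ∈ Finset.range b, ∀ k ∈ Finset.range b, ∀ s : Bool,
      WindowTest s n m k (window β N) ↔
        ‖starIf s T (finiteVector k) - starIf s (gridPoint n m) • finiteVector k‖ <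
          (1 / 2) ^ n * ‖finiteVector k‖ := by
    simp only [Finset.eventually_all, Filter.eventually_all]
    exact fun m _ k _ s => h.eventually_windowTest_iff s n m k
  filter_upwards [htest] with N hN
  rw [setOf_gaussOfCode_acceptedList]
  ext z
  refine exists_congr fun m => and_congr_right fun hm => and_congr_left fun _ => ?_
  simp only [WindowAccepts, List.mem_range]
  refine exists_congr fun k => and_congr_right fun hk => exists_congr fun s =>
    and_congr_right fun _ => ?_
  exact hN m (Finset.mem_range.2 hm) k (Finset.mem_range.2 hk) s

variable {S T}

theorem exists_acceptedPoints_dist_le {w : ℂ} (hw : w ∈ sideSpectrum S T) :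
    ∃ z ∈ acceptedPoints S T n, dist w z ≤ (1 / 2) ^ n := by
  obtain ⟨s, hs, hw⟩ := hw
  obtain ⟨m, hm⟩ := exists_dist_gridPoint_lt n w
  exact ⟨gridPoint n m, ⟨⟨m, rfl⟩, s, hs,
    hasApproxEigenvector_of_dist_lt hw ((dist_starIf s _ _).trans_lt hm)⟩,
    (dist_comm _ _).trans_le hm.le⟩

theorem eventually_exists_sideSpectrum_dist_lt (S : List Bool) (T : EllTwo →L[ℂ] EllTwo) {δ : ℝ}
    (hδ : 0 < δ) :
    ∀ᶠ n in atTop, ∀ z ∈ acceptedPoints S T n, ∃ w ∈ sideSpectrum S T, dist z w < δ := by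
  have hlim : Tendsto (fun n : ℕ => (1 / 2 : ℝ) ^ n) atTop (𝓝 0) :=
    tendsto_pow_atTop_nhds_zero_of_lt_one (by norm_num) (by norm_num)
  have hside : ∀ᶠ n : ℕ in atTop, ∀ s : Bool, ∀ z,
      HasApproxEigenvector (starIf s T) z ((1 / 2) ^ n) →
        ∃ w ∈ approximatePointSpectrum (starIf s T), dist z w < δ := by
    rw [Filter.eventually_all]
    intro s
    obtain ⟨ε, hε, hnear⟩ := exists_dist_lt_of_hasApproxEigenvector (starIf s T) hδ
    filter_upwards [hlim.eventually (gt_mem_nhds hε)] with n hn z hz using hnear z (hz.mono hn.le)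
  filter_upwards [hside] with n hn
  rintro z ⟨-, s, hs, hz⟩
  obtain ⟨w, hw, hdist⟩ := hn s _ hz
  refine ⟨starIf s w, ⟨s, hs, by rwa [starIf_starIf]⟩, ?_⟩
  rwa [← dist_starIf s, starIf_starIf]

variable {K : HausdorffSpace}

theorem coe_compactOfFinite_acceptedPoints (hK : (K : Set ℂ) = sideSpectrum S T) :
    (compactOfFinite (acceptedPoints S T n) : Set ℂ) = acceptedPoints S T n := by
  obtain ⟨w, hw⟩ := K.nonempty
  obtain ⟨z, hz, -⟩ := exists_acceptedPoints_dist_le n (hK ▸ hw)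
  exact coe_compactOfFinite (finite_acceptedPoints S T n) ⟨z, hz⟩

theorem tendsto_compactOfFinite_acceptedPoints (hK : (K : Set ℂ) = sideSpectrum S T) :
    Tendsto (fun n => compactOfFinite (acceptedPoints S T n)) atTop (𝓝 K) := by
  refine Metric.tendsto_nhds.2 fun δ hδ => ?_
  have hlim : Tendsto (fun n : ℕ => (1 / 2 : ℝ) ^ n) atTop (𝓝 0) :=
    tendsto_pow_atTop_nhds_zero_of_lt_one (by norm_num) (by norm_num)
  filter_upwards [eventually_exists_sideSpectrum_dist_lt S T (half_pos hδ),
    hlim.eventually (gt_mem_nhds (half_pos hδ))] with n hnear hn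
  refine lt_of_le_of_lt ?_ (half_lt_self hδ)
  refine Metric.hausdorffDist_le_of_mem_dist (half_pos hδ).le ?_ ?_ <;>
    rw [coe_compactOfFinite_acceptedPoints n hK, hK]
  · exact fun z hz => (hnear z hz).imp fun w hw => ⟨hw.1, hw.2.le⟩
  · exact fun w hw => (exists_acceptedPoints_dist_le n hw).imp fun z hz => ⟨hz.1, hz.2.trans hn.le⟩

theorem dist_sup_compactOfFinite_acceptedPoints_le (hK : (K : Set ℂ) = sideSpectrum S T) :
    dist (compactOfFinite (acceptedPoints S T n) ⊔ K) (compactOfFinite (acceptedPoints S T n)) ≤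
      (1 / 2) ^ n := by
  refine Metric.hausdorffDist_le_of_mem_dist (by positivity) ?_ ?_ <;>
    rw [TopologicalSpace.NonemptyCompacts.coe_sup, coe_compactOfFinite_acceptedPoints n hK, hK]
  · rintro z (hz | hz)
    · exact ⟨z, hz, by simp⟩
    · exact exists_acceptedPoints_dist_le n hz
  · exact fun w hw => ⟨w, Or.inl hw, by simp⟩

end

/-- The tower that computes `Ξ A`, as the set `sideSpectrum S (T A)`, from the matrix of `T A`,
whose entries are listed by `β A`. -/
noncomputable def matrixTower {Ω : Type} (S : List Bool) (Ξ : Ω → HausdorffSpace)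
    (T : Ω → EllTwo →L[ℂ] EllTwo) (β : Ω → ℕ → Bool) : List ℕ → Ω → HausdorffSpace
  | [n], A => compactOfFinite (acceptedPoints S (T A) n)
  | [n, b], A => compactOfFinite (acceptedUpTo S (T A) n b)
  | [n, b, N], A =>
    compactOfFinite {z | ∃ c ∈ acceptedList S n b (window (β A) N), gaussOfCode c = z}
  | _, A => Ξ A

/-- The output of `matrixTower` on the base level, in terms of parameters and bits. -/
def towerOutput (S : List Bool) (x : List ℕ × List Bool) : List GaussCode :=
  orZero (acceptedList S (x.1.getD 0 0) (x.1.getD 1 0) x.2)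

theorem primrec_towerOutput (S : List Bool) : Primrec (towerOutput S) :=
  primrec_orZero.comp (primrec_acceptedList S
    ((Primrec.list_getD 0).comp Primrec.fst (Primrec.const 0))
    ((Primrec.list_getD 0).comp Primrec.fst (Primrec.const 1)) Primrec.snd)

section

variable {Ω : Type} {S : List Bool} {T : Ω → EllTwo →L[ℂ] EllTwo} {β : Ω → ℕ → Bool}

theorem isWindowOutput_matrixTower (S : List Bool) (Ξ : Ω → HausdorffSpace)
    (T : Ω → EllTwo →L[ℂ] EllTwo) (β : Ω → ℕ → Bool) :
    IsWindowOutput β (·.getD 2 0) (towerOutput S) 3 (matrixTower S Ξ T β) := by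
  intro l hl A
  obtain ⟨n, b, N, rfl⟩ := List.length_eq_three.1 hl
  exact coe_compactOfFinite_codes _

variable {I : Type} [Encodable I] {P : ComputationalProblem Ω I} {q : ℕ → I}

theorem IsBinaryModel.isTower_matrixTower (hP : IsBinaryModel P β q)
    (hT : ∀ A, HasBinaryMatrix (T A) (β A)) (hΞ : ∀ A, (P.Ξ A : Set ℂ) = sideSpectrum S (T A)) :
    IsTower P 3 (matrixTower S P.Ξ T β) where
  general _ hl := hP.isGeneralAlgorithm (isWindowOutput_matrixTower S P.Ξ T β) hl
  top _ := rfl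
  limit l hl A := by
    match l, hl with
    | [], _ => exact tendsto_compactOfFinite_acceptedPoints (hΞ A)
    | [n], _ =>
      exact tendsto_const_nhds.congr' ((eventually_acceptedUpTo_eq S (T A) n).mono fun b hb =>
        congrArg compactOfFinite hb.symm)
    | [n, b], _ =>
      exact tendsto_const_nhds.congr' (((hT A).eventually_acceptedList_eq S n b).mono fun N hN =>
        congrArg compactOfFinite hN.symm)

theorem IsBinaryModel.isTowerOfType_matrixTower (hP : IsBinaryModel P β q)
    (hT : ∀ A, HasBinaryMatrix (T A) (β A)) (hΞ : ∀ A, (P.Ξ A : Set ℂ) = sideSpectrum S (T A)) :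
    IsTowerOfType .arithmetic P 3 (matrixTower S P.Ξ T β) := by
  have hout := isWindowOutput_matrixTower S P.Ξ T β
  have hsize : Primrec fun l : List ℕ => l.getD 2 0 :=
    (Primrec.list_getD 0).comp Primrec.id (Primrec.const 2)
  exact ⟨hP.isTower_matrixTower hT hΞ,
    hP.isBSSComputable hout hsize (primrec_towerOutput S) fun _ => orZero_ne_nil _,
    fun _ => hP.isTuringComputable hout hsize (primrec_towerOutput S)⟩

theorem IsBinaryModel.inPi_three (hP : IsBinaryModel P β q)
    (hT : ∀ A, HasBinaryMatrix (T A) (β A)) (hΞ : ∀ A, (P.Ξ A : Set ℂ) = sideSpectrum S (T A)) :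
    InPi .arithmetic P 3 := by
  have htower := hP.isTowerOfType_matrixTower hT hΞ
  refine ⟨SCI_le htower, _, fun n A => compactOfFinite (acceptedPoints S (T A) n) ⊔ P.Ξ A, htower,
    fun A n => ⟨?_, dist_sup_compactOfFinite_acceptedPoints_le n (hΞ A)⟩⟩
  rw [TopologicalSpace.NonemptyCompacts.coe_sup]
  exact Set.subset_union_right

end

/-! ## Input models -/

/-- The entries of the matrix of the Koopman operator of `F`, listed by columns. -/
noncomputable def graphBits (F : DiscreteSystem) (k : ℕ) : Bool :=
  open Classical in decide (F.1 k.unpair.2 = k.unpair.1)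

theorem sample_unpair (F : DiscreteSystem) (k : ℕ) :
    sample F k.unpair = if graphBits F k then 1 else 0 := by
  simp [sample, graphBits]

theorem hasBinaryMatrix_koopman (F : DiscreteSystem) :
    HasBinaryMatrix (koopman F) (graphBits F) := fun r c => by
  rw [koopman_single_apply, ← sample_unpair, Nat.unpair_pair]

theorem isBinaryModel_sampleProblem (Ξ : DiscreteSystem → HausdorffSpace) :
    IsBinaryModel (sampleProblem Ξ) graphBits Nat.unpair where
  primrec := Primrec.id.of_eq fun k => (Nat.pair_unpair k).symm
  bit F k := by
    change answerBit (sample F k.unpair) = _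
    rw [sample_unpair]
    cases graphBits F k <;> norm_num [answerBit]

theorem isBinaryModel_inexact (Ξ : DiscreteSystem → HausdorffSpace) (S : Set ℂ) :
    IsBinaryModel ((sampleProblem Ξ).inexact S) (fun a => graphBits a.2.choose)
      fun k => (k.unpair, 2) where
  primrec := (Primrec₂.natPair.comp Primrec.id (Primrec.const 2)).of_eq fun k =>
    congrArg (Nat.pair · 2) (Nat.pair_unpair k).symm
  bit a k := by
    change answerBit (a.1 (k.unpair, 2)) = _
    have hdist : dist (a.1 (k.unpair, 2)) (sample a.2.choose k.unpair) ≤ (1 / 2) ^ 2 :=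
      (a.2.choose_spec k.unpair 2).2
    have hre := (Complex.abs_re_le_norm _).trans ((dist_eq_norm _ _).symm.trans_le hdist)
    rw [sample_unpair, Complex.sub_re, abs_le] at hre
    cases h : graphBits a.2.choose k <;>
      simp only [h, if_true, Bool.false_eq_true, if_false, Complex.one_re, Complex.zero_re]
        at hre <;>
      simp only [answerBit, decide_eq_true_eq, decide_eq_false_iff_not, not_lt] <;>
      linarith

theorem sample_mem_gaussRationals (F : DiscreteSystem) (ij : ℕ × ℕ) :
    sample F ij ∈ gaussRationals := by
  unfold sample
  split_ifs
  · exact ⟨1, 0, by simp⟩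
  · exact ⟨0, 0, by simp⟩

theorem exists_eq_sideSpectrum_koopman {Ξ : DiscreteSystem → HausdorffSpace}
    (hΞ : Ξ = koopmanSpectrum ∨ Ξ = koopmanApproximatePointSpectrum) :
    ∃ S, ∀ F, (Ξ F : Set ℂ) = sideSpectrum S (koopman F) := by
  rcases hΞ with rfl | rfl
  · exact ⟨[false, true], fun F => (sideSpectrum_pair _).symm⟩
  · exact ⟨[false], fun F => (sideSpectrum_singleton_false _).symm⟩

theorem not_exists_isTower_two_sampleProblem {Ξ : DiscreteSystem → HausdorffSpace}
    (hΞ : Ξ = koopmanSpectrum ∨ Ξ = koopmanApproximatePointSpectrum) :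
    ¬ ∃ Γ, IsTower (sampleProblem Ξ) 2 Γ := by
  rcases hΞ with rfl | rfl
  · exact not_exists_isTower_two (fun F => approximatePointSpectrum_subset_spectrum _)
      fun F => subset_rfl
  · exact not_exists_isTower_two (fun F => subset_rfl)
      fun F => approximatePointSpectrum_subset_spectrum _

theorem SCI_eq_three {Ω I : Type} [Encodable I] {P : ComputationalProblem Ω I}
    {Γ : List ℕ → Ω → HausdorffSpace} (h : ¬ ∃ Γ, IsTower P 2 Γ)
    (hΓ : IsTowerOfType .arithmetic P 3 Γ) (α : TowerType) : SCI α P = 3 := by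
  refine le_antisymm ?_ (add_one_le_SCI h α)
  cases α with
  | general => exact SCI_le (α := .general) hΓ.isTower
  | arithmetic => exact SCI_le hΓ

theorem theorem3 (Ξ : DiscreteSystem → HausdorffSpace)
    (hΞ : Ξ = koopmanSpectrum ∨ Ξ = koopmanApproximatePointSpectrum) :
    -- no height-two tower of general algorithms, even with exact input
    ¬ InDelta .general (sampleProblem Ξ) 3 ∧
    -- arithmetic `Π₃`-towers with exact input and with inexact input (complex or rational)
    InPi .arithmetic (sampleProblem Ξ) 3 ∧
    InPi .arithmetic ((sampleProblem Ξ).inexact Set.univ) 3 ∧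
    InPi .arithmetic ((sampleProblem Ξ).inexact gaussRationals) 3 ∧
    -- the SCI is three, for either type of tower and either kind of input
    (∀ α : TowerType, SCI α (sampleProblem Ξ) = 3 ∧
      SCI α ((sampleProblem Ξ).inexact Set.univ) = 3 ∧
      SCI α ((sampleProblem Ξ).inexact gaussRationals) = 3) := by
  have hno := not_exists_isTower_two_sampleProblem hΞ
  have hno_inexact (S : Set ℂ) (hS : ∀ F ij, sample F ij ∈ S) :
      ¬ ∃ Γ, IsTower ((sampleProblem Ξ).inexact S) 2 Γ :=
    fun ⟨_, hΓ⟩ => hno (hΓ.exists_of_inexact hS)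
  obtain ⟨S, hS⟩ := exists_eq_sideSpectrum_koopman hΞ
  have hmatrix := hasBinaryMatrix_koopman
  have htower := (isBinaryModel_sampleProblem Ξ).isTowerOfType_matrixTower hmatrix hS
  have htower_inexact (R : Set ℂ) := (isBinaryModel_inexact Ξ R).isTowerOfType_matrixTower
    (fun a => hmatrix a.2.choose) fun a => hS a.2.choose
  have hPi_inexact (R : Set ℂ) := (isBinaryModel_inexact Ξ R).inPi_three
    (fun a => hmatrix a.2.choose) fun a => hS a.2.choose
  refine ⟨fun h => absurd ((add_one_le_SCI hno .general).trans h) (by norm_num),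
    (isBinaryModel_sampleProblem Ξ).inPi_three hmatrix hS, hPi_inexact _, hPi_inexact _,
    fun α => ⟨SCI_eq_three hno htower α, ?_, ?_⟩⟩
  · exact SCI_eq_three (hno_inexact _ fun _ _ => Set.mem_univ _) (htower_inexact _) α
  · exact SCI_eq_three (hno_inexact _ sample_mem_gaussRationals) (htower_inexact _) α
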